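/- Let $H$ be an infinite-dimensional separable complex Hilbert space and let $K(H)\subseteq B(H)$ be the compact operators. Let $u\in B(H)$ be a unitary operator that is not a scalar multiple of the identity, and put $$D=\mathbb C1,\qquad A=D+K(H),\qquad \tilde D=C^*(u),\qquad \tilde A=\tilde D+K(H).$$ Let $B$ be any unital C$^*$-algebra of dimension greater than $1$ and let $\tilde B=B\otimes\tilde D$ (for the unique C$^*$-tensor norm; $\tilde D$ is commutative). Consider the inclusions $D\subseteq A$, $D=\mathbb C1_B\subseteq B$, $\tilde D\subseteq\tilde A$, $D\subseteq\tilde D$, $A\subseteq\tilde A$, together with $\tilde D\to\tilde B$, $d\mapsto 1\otimes d$, and $B\to\tilde B$, $b\mapsto b\otimes 1$. Then the $*$-homomorphism of full amalgamated free product C$^*$-algebras $$\lambda: A*_D B\longrightarrow \tilde A*_{\tilde D}\tilde B$$ that arises from the inclusions $A\subseteq\tilde A$ and $B\to\tilde B$ through the universal property of $A*_DB$ is not injective. -/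

import Mathlib

open scoped TensorProduct

noncomputable section

/-- A complex *-algebra with a submultiplicative seminorm satisfying the C*-identity. It is
neither assumed to be Hausdorff nor to be complete. -/
class PreCStarAlgebra (P : Type*) extends NonUnitalSeminormedRing P, StarRing P,
    NormedSpace ℂ P, IsScalarTower ℂ P P, SMulCommClass ℂ P P, StarModule ℂ P where
  norm_star_mul_self' : ∀ x : P, ‖star x * x‖ = ‖x‖ * ‖x‖

/-! ### The Hausdorff completion of a pre-C*-algebra -/

namespace PreCStarAlgebra

open UniformSpace UniformSpace.Completion

section

variable {P : Type*} [PreCStarAlgebra P]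

theorem norm_le_star (x : P) : ‖x‖ ≤ ‖star x‖ := by
  rcases (norm_nonneg x).eq_or_lt with h | h
  · rw [← h]; exact norm_nonneg _
  · have := norm_mul_le (star x) x
    rw [norm_star_mul_self'] at this
    exact le_of_mul_le_mul_right this h

theorem norm_star' (x : P) : ‖star x‖ = ‖x‖ :=
  le_antisymm (by simpa using norm_le_star (star x)) (norm_le_star x)

theorem isometry_star : Isometry (star : P → P) :=
  Isometry.of_dist_eq fun x y => by
    rw [dist_eq_norm, dist_eq_norm, ← star_sub, norm_star']

instance : Mul (Completion P) :=
  ⟨Function.curry <| (isDenseInducing_coe.prodMap isDenseInducing_coe).extend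
    ((↑) ∘ Function.uncurry (· * ·))⟩

theorem coe_mul (a b : P) : ((a * b : P) : Completion P) = a * b :=
  ((isDenseInducing_coe.prodMap isDenseInducing_coe).extend_eq
      ((continuous_coe P).comp (@continuous_mul P _ _ _)) (a, b)).symm

instance : ContinuousMul (Completion P) where
  continuous_mul := by
    let m := (AddMonoidHom.mul : P →+ P →+ P).compr₂ toCompl
    have : Continuous fun p : P × P => m p.1 p.2 := (continuous_coe P).comp continuous_mul
    have di : IsDenseInducing (toCompl : P → Completion P) := isDenseInducing_coe
    exact (di.extend_Z_bilin di this :)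

instance : NonUnitalNormedRing (Completion P) where
  __ : NormedAddCommGroup (Completion P) := inferInstance
  __ : Mul (Completion P) := inferInstance
  zero_mul a := Completion.induction_on a (isClosed_eq (by fun_prop) continuous_const)
    fun a => by rw [← coe_zero, ← coe_mul, zero_mul]
  mul_zero a := Completion.induction_on a (isClosed_eq (by fun_prop) continuous_const)
    fun a => by rw [← coe_zero, ← coe_mul, mul_zero]
  mul_assoc a b c := Completion.induction_on₃ a b c (isClosed_eq (by fun_prop) (by fun_prop))
    fun a b c => by simp only [← coe_mul, mul_assoc]
  left_distrib a b c := Completion.induction_on₃ a b c (isClosed_eq (by fun_prop) (by fun_prop))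
    fun a b c => by simp only [← coe_mul, ← coe_add, mul_add]
  right_distrib a b c := Completion.induction_on₃ a b c (isClosed_eq (by fun_prop) (by fun_prop))
    fun a b c => by simp only [← coe_mul, ← coe_add, add_mul]
  norm_mul_le a b := Completion.induction_on₂ a b (isClosed_le (by fun_prop) (by fun_prop))
    fun a b => by simpa only [← coe_mul, norm_coe] using norm_mul_le a b

instance : Star (Completion P) := ⟨Completion.map (star : P → P)⟩

theorem coe_star (a : P) : ((star a : P) : Completion P) = star (a : Completion P) :=
  (Completion.map_coe (isometry_star (P := P)).uniformContinuous a).symm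

instance : ContinuousStar (Completion P) := ⟨Completion.continuous_map⟩

instance : StarRing (Completion P) where
  star_involutive a := Completion.induction_on a (isClosed_eq (by fun_prop) continuous_id)
    fun a => by rw [← coe_star, ← coe_star, star_star]
  star_mul a b := Completion.induction_on₂ a b (isClosed_eq (by fun_prop) (by fun_prop))
    fun a b => by simp only [← coe_mul, ← coe_star, star_mul]
  star_add a b := Completion.induction_on₂ a b (isClosed_eq (by fun_prop) (by fun_prop))
    fun a b => by simp only [← coe_add, ← coe_star, star_add]

theorem smul_mul_assoc' (c : ℂ) (a b : Completion P) : (c • a) * b = c • (a * b) := by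
  induction a, b using Completion.induction_on₂ with
  | hp =>
    exact isClosed_eq ((continuous_fst.const_smul c).mul continuous_snd)
      ((continuous_fst.mul continuous_snd).const_smul c)
  | ih a b => rw [← coe_smul, ← coe_mul, ← coe_mul, ← coe_smul, smul_mul_assoc]

theorem smul_mul_comm' (c : ℂ) (a b : Completion P) : c • (a * b) = a * (c • b) := by
  induction a, b using Completion.induction_on₂ with
  | hp =>
    exact isClosed_eq ((continuous_fst.mul continuous_snd).const_smul c)
      (continuous_fst.mul (continuous_snd.const_smul c))
  | ih a b => rw [← coe_smul, ← coe_mul, ← coe_mul, ← coe_smul, mul_smul_comm]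

theorem star_smul' (c : ℂ) (a : Completion P) : star (c • a) = star c • star a := by
  induction a using Completion.induction_on with
  | hp =>
    exact isClosed_eq (continuous_star.comp (continuous_const_smul c))
      (continuous_star.const_smul (star c))
  | ih a => rw [← coe_smul, ← coe_star, ← coe_star, ← coe_smul, star_smul]

instance : NonUnitalCStarAlgebra (Completion P) where
  __ : NonUnitalNormedRing (Completion P) := inferInstance
  __ : StarRing (Completion P) := inferInstance
  __ : NormedSpace ℂ (Completion P) := inferInstance
  complete := CompleteSpace.complete
  norm_mul_self_le a := Completion.induction_on a (isClosed_le (by fun_prop) (by fun_prop))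
    fun a => by
      rw [← coe_star, ← coe_mul, norm_coe, norm_coe, norm_star_mul_self']
  smul_assoc := smul_mul_assoc'
  smul_comm := smul_mul_comm'
  star_smul := star_smul'

/-- The canonical *-homomorphism into the completion. -/
def toCompletion : P →⋆ₙₐ[ℂ] Completion P where
  toFun x := x
  map_smul' c x := coe_smul c x
  map_zero' := coe_zero
  map_add' := coe_add
  map_mul' := coe_mul
  map_star' := coe_star

variable {C : Type*} [NonUnitalCStarAlgebra C]

theorem uniformContinuous_of_contractive (f : P →⋆ₙₐ[ℂ] C) (hf : ∀ x, ‖f x‖ ≤ ‖x‖) :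
    UniformContinuous f :=
  uniformContinuous_addMonoidHom_of_continuous (f := (f : P →+ C)) <|
    AddMonoidHomClass.continuous_of_bound (f : P →+ C) 1 fun x => by
      rw [one_mul]; exact hf x

/-- A contractive *-homomorphism into a C*-algebra extends to the completion. -/
def extend (f : P →⋆ₙₐ[ℂ] C) (hf : ∀ x, ‖f x‖ ≤ ‖x‖) : Completion P →⋆ₙₐ[ℂ] C :=
  have hu := uniformContinuous_of_contractive f hf
  { toFun := Completion.extension f
    map_smul' := fun c a => Completion.induction_on a
      (isClosed_eq (continuous_extension.comp (continuous_const_smul c))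
        (continuous_extension.const_smul c))
      fun a => by
        rw [← coe_smul, extension_coe hu, extension_coe hu]; exact map_smul f c a
    map_zero' := by rw [← coe_zero, extension_coe hu, map_zero]
    map_add' := fun a b => Completion.induction_on₂ a b
      (isClosed_eq (by fun_prop) (by fun_prop))
      fun a b => by
        rw [← coe_add, extension_coe hu, extension_coe hu, extension_coe hu, map_add]
    map_mul' := fun a b => Completion.induction_on₂ a b
      (isClosed_eq (by fun_prop) (by fun_prop))
      fun a b => by
        rw [← coe_mul, extension_coe hu, extension_coe hu, extension_coe hu, map_mul]
    map_star' := fun a => Completion.induction_on a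
      (isClosed_eq (by fun_prop) (by fun_prop))
      fun a => by
        rw [← coe_star, extension_coe hu, extension_coe hu, map_star] }

theorem extend_coe (f : P →⋆ₙₐ[ℂ] C) (hf : ∀ x, ‖f x‖ ≤ ‖x‖) (x : P) :
    extend f hf (toCompletion x) = f x :=
  extension_coe (uniformContinuous_of_contractive f hf) x

end

end PreCStarAlgebra

/-! ### C*-seminorms on a *-algebra -/

/-- A C*-seminorm on a complex *-algebra (not assumed to be unital). -/
structure CStarSeminorm (F : Type*) [NonUnitalRing F] [StarRing F] [Module ℂ F]
    extends Seminorm ℂ F where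
  mul_le' : ∀ x y, toFun (x * y) ≤ toFun x * toFun y
  star_mul_self' : ∀ x, toFun (star x * x) = toFun x * toFun x

namespace CStarSeminorm

section

variable {F : Type*} [NonUnitalRing F] [StarRing F] [Module ℂ F]

instance : CoeFun (CStarSeminorm F) (fun _ => F → ℝ) := ⟨fun p => p.toSeminorm⟩

variable (p : CStarSeminorm F)

theorem mul_le (x y : F) : p (x * y) ≤ p x * p y := p.mul_le' x y

theorem star_mul_self (x : F) : p (star x * x) = p x * p x := p.star_mul_self' x

theorem nonneg (x : F) : 0 ≤ p x := apply_nonneg p.toSeminorm x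

/-- The C*-seminorm `x ↦ ‖f x‖` of a *-homomorphism `f` into a C*-algebra. -/
def ofHom {C : Type*} [NonUnitalCStarAlgebra C] (f : F →⋆ₙₐ[ℂ] C) : CStarSeminorm F where
  toFun x := ‖f x‖
  map_zero' := by simp
  add_le' x y := by rw [map_add]; exact norm_add_le _ _
  neg' x := by rw [map_neg, norm_neg]
  smul' c x := by rw [map_smul, norm_smul]
  mul_le' x y := by rw [map_mul]; exact norm_mul_le _ _
  star_mul_self' x := by
    rw [map_mul, map_star]; exact CStarRing.norm_star_mul_self

theorem ofHom_apply {C : Type*} [NonUnitalCStarAlgebra C] (f : F →⋆ₙₐ[ℂ] C) (x : F) :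
    ofHom f x = ‖f x‖ := rfl

instance : Zero (CStarSeminorm F) :=
  ⟨{ (0 : Seminorm ℂ F) with
      mul_le' := fun _ _ => (mul_zero (0 : ℝ)).ge
      star_mul_self' := fun _ => (mul_zero (0 : ℝ)).symm }⟩

theorem zero_apply (x : F) : (0 : CStarSeminorm F) x = 0 := rfl

/-- The pointwise supremum of a nonempty, pointwise bounded set of C*-seminorms. -/
def sup (S : Set (CStarSeminorm F)) (hne : S.Nonempty)
    (hS : ∀ x, BddAbove (Set.range fun p : S => p.1 x)) : CStarSeminorm F :=
  haveI : Nonempty S := hne.to_subtype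
  { toFun := fun x => ⨆ p : S, p.1 x
    map_zero' := by simp
    add_le' := fun x y => ciSup_le fun p => (map_add_le_add p.1.toSeminorm x y).trans
      (add_le_add (le_ciSup (hS x) p) (le_ciSup (hS y) p))
    neg' := fun x => by simp
    smul' := fun c x => by
      simp only [map_smul_eq_mul]
      exact (Real.mul_iSup_of_nonneg (norm_nonneg c) _).symm
    mul_le' := fun x y => ciSup_le fun p => (p.1.mul_le x y).trans
      (mul_le_mul (le_ciSup (hS x) p) (le_ciSup (hS y) p) (p.1.nonneg y)
        ((p.1.nonneg x).trans (le_ciSup (hS x) p)))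
    star_mul_self' := fun x => by
      have h0 : 0 ≤ ⨆ p : S, p.1 x := Real.iSup_nonneg fun p => p.1.nonneg x
      refine le_antisymm (ciSup_le fun p => ?_) ?_
      · rw [p.1.star_mul_self]
        exact mul_self_le_mul_self (p.1.nonneg x) (le_ciSup (hS x) p)
      · have hb : ∀ p : S, p.1 x ≤ √(⨆ p : S, p.1 (star x * x)) := fun p =>
          Real.le_sqrt_of_sq_le <| by
            rw [sq, ← p.1.star_mul_self]
            exact le_ciSup (hS (star x * x)) p
        have h1 := ciSup_le hb
        have h2 := mul_self_le_mul_self h0 h1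
        rwa [Real.mul_self_sqrt (Real.iSup_nonneg fun p => p.1.nonneg _)] at h2 }

theorem sup_apply (S : Set (CStarSeminorm F)) (hne : S.Nonempty)
    (hS : ∀ x, BddAbove (Set.range fun p : S => p.1 x)) (x : F) :
    sup S hne hS x = ⨆ p : S, p.1 x := rfl

theorem le_sup {S : Set (CStarSeminorm F)} (hne : S.Nonempty)
    (hS : ∀ x, BddAbove (Set.range fun p : S => p.1 x)) {p : CStarSeminorm F} (hp : p ∈ S)
    (x : F) : p x ≤ sup S hne hS x := le_ciSup (hS x) ⟨p, hp⟩

theorem sup_eq_zero {S : Set (CStarSeminorm F)} (hne : S.Nonempty)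
    (hS : ∀ x, BddAbove (Set.range fun p : S => p.1 x)) {x : F} (hx : ∀ p ∈ S, p x = 0) :
    sup S hne hS x = 0 := by
  have : Nonempty S := hne.to_subtype
  rw [sup_apply, iSup_congr fun p : S => hx p.1 p.2, ciSup_const]

/-- The *-algebra `F`, regarded as a seminormed *-algebra with the seminorm `p`. -/
def Pre (_p : CStarSeminorm F) : Type _ := F

variable [IsScalarTower ℂ F F] [SMulCommClass ℂ F F] [StarModule ℂ F]

instance : PreCStarAlgebra p.Pre :=
  { (inferInstance : NonUnitalRing F), p.toSeminorm.toSeminormedAddCommGroup,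
    (inferInstance : StarRing F), (inferInstance : Module ℂ F),
    (inferInstance : IsScalarTower ℂ F F), (inferInstance : SMulCommClass ℂ F F),
    (inferInstance : StarModule ℂ F) with
    norm_mul_le := p.mul_le
    norm_smul_le := fun c x => (map_smul_eq_mul p.toSeminorm c x).le
    norm_star_mul_self' := p.star_mul_self }

/-- The C*-algebra obtained from the *-algebra `F` by separation and completion with respect
to the C*-seminorm `p`. -/
def Completion : Type _ := UniformSpace.Completion p.Pre

instance : NonUnitalCStarAlgebra p.Completion :=
  (inferInstance : NonUnitalCStarAlgebra (UniformSpace.Completion p.Pre))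

/-- The canonical *-homomorphism from `F` to its completion with respect to `p`. -/
def incl : F →⋆ₙₐ[ℂ] p.Completion := PreCStarAlgebra.toCompletion (P := p.Pre)

theorem norm_incl (x : F) : ‖p.incl x‖ = p x :=
  UniformSpace.Completion.norm_coe (E := p.Pre) x

theorem incl_eq_incl {x y : F} (h : p (x - y) = 0) : p.incl x = p.incl y := by
  rw [← sub_eq_zero, ← map_sub, ← norm_eq_zero, norm_incl, h]

theorem denseRange_incl : DenseRange p.incl :=
  UniformSpace.Completion.denseRange_coe (α := p.Pre)

variable {C : Type*} [NonUnitalCStarAlgebra C]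

/-- A *-homomorphism from `F` to a C*-algebra which is contractive for `p` extends to the
completion. -/
def lift (f : F →⋆ₙₐ[ℂ] C) (hf : ∀ x, ‖f x‖ ≤ p x) : p.Completion →⋆ₙₐ[ℂ] C :=
  PreCStarAlgebra.extend (P := p.Pre) f hf

theorem lift_incl (f : F →⋆ₙₐ[ℂ] C) (hf : ∀ x, ‖f x‖ ≤ p x) (x : F) :
    p.lift f hf (p.incl x) = f x :=
  PreCStarAlgebra.extend_coe (P := p.Pre) f hf x

end

end CStarSeminorm

/-! ### The free (non-unital) *-algebra on a set with involution -/

namespace FreeStar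

instance {X : Type*} [InvolutiveStar X] : StarMul (FreeSemigroup X) where
  star w := (FreeSemigroup.lift (fun x => MulOpposite.op (FreeSemigroup.of (star x))) w).unop
  star_involutive w := by
    induction w using FreeSemigroup.recOnMul with
    | ih1 x => simp
    | ih2 x w hx hw =>
      simp only [map_mul, MulOpposite.unop_mul] at hx hw ⊢
      rw [hx, hw]
  star_mul v w := by rw [map_mul, MulOpposite.unop_mul]

theorem star_of {X : Type*} [InvolutiveStar X] (x : X) :
    star (FreeSemigroup.of x) = FreeSemigroup.of (star x) := rfl

section

variable {S : Type*} [Semigroup S] [StarMul S]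

/-- The conjugate-linear involution of a semigroup algebra, `∑ c_w w ↦ ∑ conj(c_w) w*`. -/
def starHom : MonoidAlgebra ℂ S →+ MonoidAlgebra ℂ S :=
  (Finsupp.liftAddHom fun w : S =>
    (MonoidAlgebra.singleAddHom (star w)).comp (starAddEquiv : ℂ ≃+ ℂ).toAddMonoidHom).comp
      MonoidAlgebra.coeffAddEquiv.toAddMonoidHom

theorem starHom_single (w : S) (c : ℂ) :
    starHom (MonoidAlgebra.single w c) = MonoidAlgebra.single (star w) (star c) := by
  simp [starHom]

instance : StarRing (MonoidAlgebra ℂ S) where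
  star := starHom
  star_involutive x := by
    induction x using MonoidAlgebra.induction_linear with
    | zero => simp
    | add x y hx hy => rw [map_add, map_add, hx, hy]
    | single w c => rw [starHom_single, starHom_single, star_star, star_star]
  star_mul x y := by
    change starHom (x * y) = starHom y * starHom x
    induction x using MonoidAlgebra.induction_linear with
    | zero => simp
    | add x x' hx hx' => rw [add_mul, map_add, map_add, mul_add, hx, hx']
    | single w c =>
      induction y using MonoidAlgebra.induction_linear with
      | zero => simp
      | add y y' hy hy' => rw [mul_add, map_add, map_add, add_mul, hy, hy']
      | single v d =>
        rw [MonoidAlgebra.single_mul_single, starHom_single, starHom_single, starHom_single,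
          MonoidAlgebra.single_mul_single, star_mul, star_mul]
  star_add x y := map_add starHom x y

theorem star_single (w : S) (c : ℂ) :
    star (MonoidAlgebra.single w c) = MonoidAlgebra.single (star w) (star c) :=
  starHom_single w c

instance : StarModule ℂ (MonoidAlgebra ℂ S) where
  star_smul c x := by
    induction x using MonoidAlgebra.induction_linear with
    | zero => simp
    | add x y hx hy => rw [smul_add, star_add, star_add, smul_add, hx, hy]
    | single w d =>
      rw [MonoidAlgebra.smul_single, star_single, star_single, MonoidAlgebra.smul_single,
        star_smul]

end

end FreeStar

/-- The free non-unital complex *-algebra on a set `X` with an involution: the linear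
combinations of nonempty words in `X`, where the adjoint of a letter `x` is the letter `star x`. -/
abbrev FreeStarAlgebra (X : Type*) : Type _ := MonoidAlgebra ℂ (FreeSemigroup X)

namespace FreeStarAlgebra

variable {X : Type*}

/-- The generator of the free *-algebra given by a letter. -/
def gen (x : X) : FreeStarAlgebra X := MonoidAlgebra.single (FreeSemigroup.of x) 1

theorem star_gen [InvolutiveStar X] (x : X) : star (gen x) = gen (star x) := by
  rw [gen, FreeStar.star_single, FreeStar.star_of, star_one, gen]

@[elab_as_elim]
theorem induction {P : FreeStarAlgebra X → Prop} (z : FreeStarAlgebra X) (zero : P 0)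
    (gen : ∀ x, P (gen x)) (add : ∀ y z, P y → P z → P (y + z))
    (smul : ∀ (c : ℂ) z, P z → P (c • z)) (mul : ∀ y z, P y → P z → P (y * z)) : P z := by
  induction z using MonoidAlgebra.induction_linear with
  | zero => exact zero
  | add x y hx hy => exact add x y hx hy
  | single w c =>
    have h : P (MonoidAlgebra.single w 1) := by
      induction w using FreeSemigroup.recOnMul with
      | ih1 x => exact gen x
      | ih2 x w hx hw =>
        have := mul _ _ hx hw
        rwa [MonoidAlgebra.single_mul_single, mul_one] at this
    have := smul c _ h
    rwa [MonoidAlgebra.smul_single, smul_eq_mul, mul_one] at this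

variable [InvolutiveStar X] {C : Type*} [NonUnitalCStarAlgebra C]

/-- The *-homomorphism on the free *-algebra determined by the images of the generators. -/
def lift (f : X → C) (hf : ∀ x, f (star x) = star (f x)) : FreeStarAlgebra X →⋆ₙₐ[ℂ] C :=
  { MonoidAlgebra.liftMagma ℂ (FreeSemigroup.lift f) with
    map_star' := fun z => by
      change MonoidAlgebra.liftMagma ℂ (FreeSemigroup.lift f) (star z)
        = star (MonoidAlgebra.liftMagma ℂ (FreeSemigroup.lift f) z)
      have hg : ∀ x, MonoidAlgebra.liftMagma ℂ (FreeSemigroup.lift f) (gen x) = f x := fun x => by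
        simp [gen]
      induction z using FreeStarAlgebra.induction with
      | zero => simp
      | gen x => rw [star_gen, hg, hg, hf]
      | add y z hy hz => rw [star_add, map_add, map_add, star_add, hy, hz]
      | smul c z hz => rw [star_smul, map_smul, map_smul, star_smul, hz]
      | mul y z hy hz => rw [star_mul, map_mul, map_mul, star_mul, hy, hz] }

theorem lift_gen (f : X → C) (hf : ∀ x, f (star x) = star (f x)) (x : X) :
    lift f hf (gen x) = f x := by
  change MonoidAlgebra.liftMagma ℂ (FreeSemigroup.lift f) (gen x) = f x
  simp [gen]

end FreeStarAlgebra

/-! ### The full amalgamated free product -/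

namespace FullAmalg

/-- The generators of the full free product: the disjoint union of the two algebras. -/
instance {A B : Type*} [InvolutiveStar A] [InvolutiveStar B] : InvolutiveStar (A ⊕ B) where
  star := Sum.map star star
  star_involutive x := by cases x <;> simp

variable {D A B : Type*} [NonUnitalCStarAlgebra D] [NonUnitalCStarAlgebra A]
  [NonUnitalCStarAlgebra B]

/-- The generator attached to an element of `A`. -/
def l (B : Type*) (a : A) : FreeStarAlgebra (A ⊕ B) := FreeStarAlgebra.gen (Sum.inl a)

/-- The generator attached to an element of `B`. -/
def r (A : Type*) (b : B) : FreeStarAlgebra (A ⊕ B) := FreeStarAlgebra.gen (Sum.inr b)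

theorem star_l (a : A) : star (l B a) = l B (star a) := FreeStarAlgebra.star_gen _

theorem star_r (b : B) : star (r A b) = r A (star b) := FreeStarAlgebra.star_gen _

/-- The C*-seminorms on the free *-algebra on `A ⊔ B` that respect the relations of the
amalgamated free product: those for which `A` and `B` are mapped in by *-homomorphisms
(compatibility with the adjoint being built into the free *-algebra) that agree on `D`. -/
structure Admissible (φA : D →⋆ₙₐ[ℂ] A) (φB : D →⋆ₙₐ[ℂ] B)
    (p : CStarSeminorm (FreeStarAlgebra (A ⊕ B))) : Prop where
  l_add : ∀ a a', p (l B (a + a') - (l B a + l B a')) = 0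
  l_smul : ∀ (c : ℂ) a, p (l B (c • a) - c • l B a) = 0
  l_mul : ∀ a a', p (l B (a * a') - l B a * l B a') = 0
  r_add : ∀ b b', p (r A (b + b') - (r A b + r A b')) = 0
  r_smul : ∀ (c : ℂ) b, p (r A (c • b) - c • r A b) = 0
  r_mul : ∀ b b', p (r A (b * b') - r A b * r A b') = 0
  amalg : ∀ d, p (l B (φA d) - r A (φB d)) = 0

namespace Admissible

variable {φA : D →⋆ₙₐ[ℂ] A} {φB : D →⋆ₙₐ[ℂ] B} {p : CStarSeminorm (FreeStarAlgebra (A ⊕ B))}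

/-- The *-homomorphism from `A` given by an admissible seminorm. -/
def inl (hp : Admissible φA φB p) : A →⋆ₙₐ[ℂ] p.Completion where
  toFun a := p.incl (l B a)
  map_smul' c a := by rw [p.incl_eq_incl (hp.l_smul c a), map_smul]; rfl
  map_zero' := by
    have := p.incl_eq_incl (hp.l_smul 0 0)
    simpa using this
  map_add' a a' := by rw [p.incl_eq_incl (hp.l_add a a'), map_add]
  map_mul' a a' := by rw [p.incl_eq_incl (hp.l_mul a a'), map_mul]
  map_star' a := by rw [← star_l, map_star]

/-- The *-homomorphism from `B` given by an admissible seminorm. -/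
def inr (hp : Admissible φA φB p) : B →⋆ₙₐ[ℂ] p.Completion where
  toFun b := p.incl (r A b)
  map_smul' c b := by rw [p.incl_eq_incl (hp.r_smul c b), map_smul]; rfl
  map_zero' := by
    have := p.incl_eq_incl (hp.r_smul 0 0)
    simpa using this
  map_add' b b' := by rw [p.incl_eq_incl (hp.r_add b b'), map_add]
  map_mul' b b' := by rw [p.incl_eq_incl (hp.r_mul b b'), map_mul]
  map_star' b := by rw [← star_r, map_star]

theorem le_l (hp : Admissible φA φB p) (a : A) : p (l B a) ≤ ‖a‖ := by
  rw [← p.norm_incl]; exact NonUnitalStarAlgHom.norm_apply_le hp.inl a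

theorem le_r (hp : Admissible φA φB p) (b : B) : p (r A b) ≤ ‖b‖ := by
  rw [← p.norm_incl]; exact NonUnitalStarAlgHom.norm_apply_le hp.inr b

end Admissible

variable (φA : D →⋆ₙₐ[ℂ] A) (φB : D →⋆ₙₐ[ℂ] B)

theorem exists_bound (x : FreeStarAlgebra (A ⊕ B)) :
    ∃ M : ℝ, ∀ p, Admissible φA φB p → p x ≤ M := by
  induction x using FreeStarAlgebra.induction with
  | zero => exact ⟨0, fun p _ => (map_zero p.toSeminorm).le⟩
  | gen x =>
    cases x with
    | inl a => exact ⟨‖a‖, fun p hp => hp.le_l a⟩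
    | inr b => exact ⟨‖b‖, fun p hp => hp.le_r b⟩
  | add x y hx hy =>
    obtain ⟨M, hM⟩ := hx
    obtain ⟨N, hN⟩ := hy
    exact ⟨M + N, fun p hp => (map_add_le_add p.toSeminorm x y).trans
      (add_le_add (hM p hp) (hN p hp))⟩
  | smul c x hx =>
    obtain ⟨M, hM⟩ := hx
    exact ⟨‖c‖ * M, fun p hp => (map_smul_eq_mul p.toSeminorm c x).le.trans
      (mul_le_mul_of_nonneg_left (hM p hp) (norm_nonneg c))⟩
  | mul x y hx hy =>
    obtain ⟨M, hM⟩ := hx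
    obtain ⟨N, hN⟩ := hy
    exact ⟨M * N, fun p hp => (p.mul_le x y).trans
      (mul_le_mul (hM p hp) (hN p hp) (p.nonneg y) ((p.nonneg x).trans (hM p hp)))⟩

theorem admissible_nonempty : {p | Admissible φA φB p}.Nonempty :=
  ⟨0, ⟨fun _ _ => rfl, fun _ _ => rfl, fun _ _ => rfl, fun _ _ => rfl, fun _ _ => rfl,
    fun _ _ => rfl, fun _ => rfl⟩⟩

theorem admissible_bddAbove (x : FreeStarAlgebra (A ⊕ B)) :
    BddAbove (Set.range fun p : {p | Admissible φA φB p} => p.1 x) := by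
  obtain ⟨M, hM⟩ := exists_bound φA φB x
  exact ⟨M, by rintro _ ⟨p, rfl⟩; exact hM p.1 p.2⟩

/-- The largest admissible C*-seminorm. -/
def maxSeminorm : CStarSeminorm (FreeStarAlgebra (A ⊕ B)) :=
  CStarSeminorm.sup {p | Admissible φA φB p} (admissible_nonempty φA φB)
    (admissible_bddAbove φA φB)

theorem admissible_maxSeminorm : Admissible φA φB (maxSeminorm φA φB) where
  l_add a a' := CStarSeminorm.sup_eq_zero _ _ fun _ hp => Admissible.l_add hp a a'
  l_smul c a := CStarSeminorm.sup_eq_zero _ _ fun _ hp => Admissible.l_smul hp c a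
  l_mul a a' := CStarSeminorm.sup_eq_zero _ _ fun _ hp => Admissible.l_mul hp a a'
  r_add b b' := CStarSeminorm.sup_eq_zero _ _ fun _ hp => Admissible.r_add hp b b'
  r_smul c b := CStarSeminorm.sup_eq_zero _ _ fun _ hp => Admissible.r_smul hp c b
  r_mul b b' := CStarSeminorm.sup_eq_zero _ _ fun _ hp => Admissible.r_mul hp b b'
  amalg d := CStarSeminorm.sup_eq_zero _ _ fun _ hp => Admissible.amalg hp d

end FullAmalg

/-- The full amalgamated free product C*-algebra `A *_D B` with respect to the *-homomorphisms
`φA : D → A` and `φB : D → B`: the universal C*-algebra generated by `A` and `B` subject to the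
relations of `A`, those of `B` and `φA d = φB d` for `d ∈ D`. -/
def FullAmalgFreeProduct {D A B : Type*} [NonUnitalCStarAlgebra D] [NonUnitalCStarAlgebra A]
    [NonUnitalCStarAlgebra B] (φA : D →⋆ₙₐ[ℂ] A) (φB : D →⋆ₙₐ[ℂ] B) : Type _ :=
  (FullAmalg.maxSeminorm φA φB).Completion

namespace FullAmalgFreeProduct

variable {D A B : Type*} [NonUnitalCStarAlgebra D] [NonUnitalCStarAlgebra A]
  [NonUnitalCStarAlgebra B] (φA : D →⋆ₙₐ[ℂ] A) (φB : D →⋆ₙₐ[ℂ] B)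

instance : NonUnitalCStarAlgebra (FullAmalgFreeProduct φA φB) :=
  (inferInstance : NonUnitalCStarAlgebra (FullAmalg.maxSeminorm φA φB).Completion)

/-- The canonical *-homomorphism from the free *-algebra on `A ⊔ B` to `A *_D B`. -/
def ofFree : FreeStarAlgebra (A ⊕ B) →⋆ₙₐ[ℂ] FullAmalgFreeProduct φA φB :=
  (FullAmalg.maxSeminorm φA φB).incl

theorem denseRange_ofFree : DenseRange (ofFree φA φB) :=
  (FullAmalg.maxSeminorm φA φB).denseRange_incl

/-- The canonical *-homomorphism `σ_A : A → A *_D B`. -/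
def inl : A →⋆ₙₐ[ℂ] FullAmalgFreeProduct φA φB := (FullAmalg.admissible_maxSeminorm φA φB).inl

/-- The canonical *-homomorphism `σ_B : B → A *_D B`. -/
def inr : B →⋆ₙₐ[ℂ] FullAmalgFreeProduct φA φB := (FullAmalg.admissible_maxSeminorm φA φB).inr

theorem inl_comp (d : D) : inl φA φB (φA d) = inr φA φB (φB d) :=
  CStarSeminorm.incl_eq_incl _ ((FullAmalg.admissible_maxSeminorm φA φB).amalg d)

variable {φA φB} {C : Type*} [NonUnitalCStarAlgebra C]

/-- The *-homomorphism of the free *-algebra determined by *-homomorphisms of `A` and `B`. -/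
def freeLift (πA : A →⋆ₙₐ[ℂ] C) (πB : B →⋆ₙₐ[ℂ] C) : FreeStarAlgebra (A ⊕ B) →⋆ₙₐ[ℂ] C :=
  FreeStarAlgebra.lift (Sum.elim πA πB) (by
    rintro (a | b)
    · exact map_star πA a
    · exact map_star πB b)

theorem freeLift_l (πA : A →⋆ₙₐ[ℂ] C) (πB : B →⋆ₙₐ[ℂ] C) (a : A) :
    freeLift πA πB (FullAmalg.l B a) = πA a := FreeStarAlgebra.lift_gen _ _ _

theorem freeLift_r (πA : A →⋆ₙₐ[ℂ] C) (πB : B →⋆ₙₐ[ℂ] C) (b : B) :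
    freeLift πA πB (FullAmalg.r A b) = πB b := FreeStarAlgebra.lift_gen _ _ _

theorem admissible_ofHom (πA : A →⋆ₙₐ[ℂ] C) (πB : B →⋆ₙₐ[ℂ] C)
    (h : ∀ d, πA (φA d) = πB (φB d)) :
    FullAmalg.Admissible φA φB (CStarSeminorm.ofHom (freeLift πA πB)) := by
  constructor <;> intros <;>
    simp [CStarSeminorm.ofHom_apply, freeLift_l, freeLift_r, h]

/-- The *-homomorphism `A *_D B → C` obtained by the universal property from *-homomorphisms
`πA : A → C` and `πB : B → C` that agree on `D`. -/
def lift (πA : A →⋆ₙₐ[ℂ] C) (πB : B →⋆ₙₐ[ℂ] C) (h : ∀ d, πA (φA d) = πB (φB d)) :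
    FullAmalgFreeProduct φA φB →⋆ₙₐ[ℂ] C :=
  (FullAmalg.maxSeminorm φA φB).lift (freeLift πA πB)
    (CStarSeminorm.le_sup _ _ (admissible_ofHom πA πB h))

theorem lift_inl (πA : A →⋆ₙₐ[ℂ] C) (πB : B →⋆ₙₐ[ℂ] C) (h : ∀ d, πA (φA d) = πB (φB d)) (a : A) :
    lift πA πB h (inl φA φB a) = πA a :=
  (CStarSeminorm.lift_incl _ _ _ _).trans (freeLift_l πA πB a)

theorem lift_inr (πA : A →⋆ₙₐ[ℂ] C) (πB : B →⋆ₙₐ[ℂ] C) (h : ∀ d, πA (φA d) = πB (φB d)) (b : B) :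
    lift πA πB h (inr φA φB b) = πB b :=
  (CStarSeminorm.lift_incl _ _ _ _).trans (freeLift_r πA πB b)

/-- `A *_D B` is generated by the images of `A` and `B`, so that a *-homomorphism on it is
determined by its restrictions to `A` and to `B`. -/
theorem hom_ext {f g : FullAmalgFreeProduct φA φB →⋆ₙₐ[ℂ] C}
    (hA : ∀ a, f (inl φA φB a) = g (inl φA φB a))
    (hB : ∀ b, f (inr φA φB b) = g (inr φA φB b)) : f = g := by
  have hd := denseRange_ofFree φA φB
  refine DFunLike.coe_injective (hd.equalizer
    (AddMonoidHomClass.continuous_of_bound f 1 fun x => by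
      rw [one_mul]; exact NonUnitalStarAlgHom.norm_apply_le f x)
    (AddMonoidHomClass.continuous_of_bound g 1 fun x => by
      rw [one_mul]; exact NonUnitalStarAlgHom.norm_apply_le g x) ?_)
  funext x
  induction x using FreeStarAlgebra.induction with
  | zero => simp
  | gen x =>
    cases x with
    | inl a => exact hA a
    | inr b => exact hB b
  | add y z hy hz => simp only [Function.comp_apply, map_add] at *; rw [hy, hz]
  | smul c z hz => simp only [Function.comp_apply, map_smul] at *; rw [hz]
  | mul y z hy hz => simp only [Function.comp_apply, map_mul] at *; rw [hy, hz]

variable {D' A' B' : Type*} [NonUnitalCStarAlgebra D'] [NonUnitalCStarAlgebra A']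
  [NonUnitalCStarAlgebra B'] {φA' : D' →⋆ₙₐ[ℂ] A'} {φB' : D' →⋆ₙₐ[ℂ] B'}

/-- The *-homomorphism `λ : A *_D B → A' *_D' B'` arising from *-homomorphisms `lA : A → A'`,
`lB : B → B'` and `lD : D → D'` compatible with the given maps. -/
def map (lD : D →⋆ₙₐ[ℂ] D') (lA : A →⋆ₙₐ[ℂ] A') (lB : B →⋆ₙₐ[ℂ] B')
    (hA : ∀ d, lA (φA d) = φA' (lD d)) (hB : ∀ d, lB (φB d) = φB' (lD d)) :
    FullAmalgFreeProduct φA φB →⋆ₙₐ[ℂ] FullAmalgFreeProduct φA' φB' :=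
  lift ((inl φA' φB').comp lA) ((inr φA' φB').comp lB) fun d => by
    rw [NonUnitalStarAlgHom.comp_apply, NonUnitalStarAlgHom.comp_apply, hA, hB, inl_comp]

theorem map_inl (lD : D →⋆ₙₐ[ℂ] D') (lA : A →⋆ₙₐ[ℂ] A') (lB : B →⋆ₙₐ[ℂ] B')
    (hA : ∀ d, lA (φA d) = φA' (lD d)) (hB : ∀ d, lB (φB d) = φB' (lD d)) (a : A) :
    map lD lA lB hA hB (inl φA φB a) = inl φA' φB' (lA a) := lift_inl _ _ _ a

theorem map_inr (lD : D →⋆ₙₐ[ℂ] D') (lA : A →⋆ₙₐ[ℂ] A') (lB : B →⋆ₙₐ[ℂ] B')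
    (hA : ∀ d, lA (φA d) = φA' (lD d)) (hB : ∀ d, lB (φB d) = φB' (lD d)) (b : B) :
    map lD lA lB hA hB (inr φA φB b) = inr φA' φB' (lB b) := lift_inr _ _ _ b

end FullAmalgFreeProduct

/-! ### The C*-tensor product -/

namespace CStarTensor

variable {B E : Type*} [CStarAlgebra B] [CStarAlgebra E]

/-- `b ↦ b ⊗ 1` as a *-homomorphism into the algebraic tensor product. -/
def algLeft (B E : Type*) [CStarAlgebra B] [CStarAlgebra E] : B →⋆ₙₐ[ℂ] B ⊗[ℂ] E where
  toFun b := b ⊗ₜ 1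
  map_smul' c b := by simp [TensorProduct.smul_tmul']
  map_zero' := by simp
  map_add' b b' := TensorProduct.add_tmul b b' 1
  map_mul' b b' := by simp
  map_star' b := by simp

/-- `e ↦ 1 ⊗ e` as a *-homomorphism into the algebraic tensor product. -/
def algRight (B E : Type*) [CStarAlgebra B] [CStarAlgebra E] : E →⋆ₙₐ[ℂ] B ⊗[ℂ] E where
  toFun e := 1 ⊗ₜ e
  map_smul' c e := by simp
  map_zero' := by simp
  map_add' e e' := TensorProduct.tmul_add 1 e e'
  map_mul' e e' := by simp
  map_star' e := by simp

theorem le_norm (p : CStarSeminorm (B ⊗[ℂ] E)) (b : B) (e : E) :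
    p (b ⊗ₜ e) ≤ ‖b‖ * ‖e‖ := by
  have h : (b ⊗ₜ[ℂ] e : B ⊗[ℂ] E) = algLeft B E b * algRight B E e := by
    simp [algLeft, algRight]
  have h1 : p (algLeft B E b) ≤ ‖b‖ := by
    rw [← p.norm_incl]
    exact NonUnitalStarAlgHom.norm_apply_le (p.incl.comp (algLeft B E)) b
  have h2 : p (algRight B E e) ≤ ‖e‖ := by
    rw [← p.norm_incl]
    exact NonUnitalStarAlgHom.norm_apply_le (p.incl.comp (algRight B E)) e
  rw [h]
  exact (p.mul_le _ _).trans (mul_le_mul h1 h2 (p.nonneg _) (norm_nonneg _))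

theorem exists_bound (x : B ⊗[ℂ] E) :
    ∃ M : ℝ, ∀ p : CStarSeminorm (B ⊗[ℂ] E), p x ≤ M := by
  induction x using TensorProduct.induction_on with
  | zero => exact ⟨0, fun p => (map_zero p.toSeminorm).le⟩
  | tmul b e => exact ⟨‖b‖ * ‖e‖, fun p => le_norm p b e⟩
  | add x y hx hy =>
    obtain ⟨M, hM⟩ := hx
    obtain ⟨N, hN⟩ := hy
    exact ⟨M + N, fun p => (map_add_le_add p.toSeminorm x y).trans (add_le_add (hM p) (hN p))⟩

/-- The largest C*-seminorm on the algebraic tensor product of two unital C*-algebras. -/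
def maxSeminorm (B E : Type*) [CStarAlgebra B] [CStarAlgebra E] : CStarSeminorm (B ⊗[ℂ] E) :=
  CStarSeminorm.sup Set.univ ⟨0, trivial⟩ fun x => by
    obtain ⟨M, hM⟩ := exists_bound x
    exact ⟨M, by rintro _ ⟨p, rfl⟩; exact hM p.1⟩

end CStarTensor

/-- The C*-tensor product `B ⊗ E` of unital C*-algebras: the completion of the algebraic tensor
product with respect to the largest C*-norm. If one of the two factors is commutative (or, more
generally, nuclear), this is the only C*-norm on the algebraic tensor product. -/
def CStarTensor (B E : Type*) [CStarAlgebra B] [CStarAlgebra E] : Type _ :=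
  (CStarTensor.maxSeminorm B E).Completion

namespace CStarTensor

variable (B E : Type*) [CStarAlgebra B] [CStarAlgebra E]

instance : NonUnitalCStarAlgebra (CStarTensor B E) :=
  (inferInstance : NonUnitalCStarAlgebra (maxSeminorm B E).Completion)

/-- The canonical *-homomorphism from the algebraic tensor product to its completion. -/
def ofAlg : B ⊗[ℂ] E →⋆ₙₐ[ℂ] CStarTensor B E := (maxSeminorm B E).incl

/-- The inclusion `b ↦ b ⊗ 1`. -/
def inclLeft : B →⋆ₙₐ[ℂ] CStarTensor B E := (ofAlg B E).comp (algLeft B E)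

/-- The inclusion `e ↦ 1 ⊗ e`. -/
def inclRight : E →⋆ₙₐ[ℂ] CStarTensor B E := (ofAlg B E).comp (algRight B E)

end CStarTensor

/-! ### The algebras `C + K(H)` -/

namespace CompactPerturbation

open ContinuousLinearMap Complex

variable {H : Type*} [NormedAddCommGroup H] [InnerProductSpace ℂ H] [CompleteSpace H]

/-- If `‖T v‖² ≤ M ‖S v‖ ‖v‖` for all `v` and `S` is compact, then so is `T`. -/
theorem isCompactOperator_of_le {S T : H →L[ℂ] H} (hS : IsCompactOperator S) {M : ℝ} (hM : 0 ≤ M)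
    (h : ∀ v, ‖T v‖ ^ 2 ≤ M * ‖S v‖ * ‖v‖) : IsCompactOperator T := by
  refine (isCompactOperator_iff_isCompact_closure_image_closedBall (T : H →ₗ[ℂ] H)
    one_pos).2 ?_
  change IsCompact (closure (T '' Metric.closedBall 0 1))
  have hSt : TotallyBounded (S '' Metric.closedBall 0 1) :=
    (hS.isCompact_closure_image_closedBall 1).totallyBounded.subset subset_closure
  refine (TotallyBounded.closure ?_).isCompact_of_isClosed isClosed_closure
  rw [Metric.totallyBounded_iff]
  intro ε hε
  have hδ : 0 < ε ^ 2 / (2 * M + 1) := by positivity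
  obtain ⟨t, htS, htf, ht⟩ := totallyBounded_iff_subset.1 hSt _ (Metric.dist_mem_uniformity hδ)
  have htS' : ∀ y : H, ∃ v : H, y ∈ t → v ∈ Metric.closedBall (0 : H) 1 ∧ S v = y := fun y => by
    by_cases hy : y ∈ t
    · obtain ⟨v, hv, hvy⟩ := htS hy
      exact ⟨v, fun _ => ⟨hv, hvy⟩⟩
    · exact ⟨0, fun h => absurd h hy⟩
  choose g hgg using htS'
  have hg : ∀ {y}, y ∈ t → g y ∈ Metric.closedBall (0 : H) 1 := fun hy => (hgg _ hy).1
  have hgS : ∀ {y}, y ∈ t → S (g y) = y := fun hy => (hgg _ hy).2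
  refine ⟨(fun y => T (g y)) '' t, htf.image _, ?_⟩
  rintro _ ⟨v, hv, rfl⟩
  obtain ⟨y, hy, hvy⟩ := Set.mem_iUnion₂.1 (ht ⟨v, hv, rfl⟩)
  refine Set.mem_iUnion₂.2 ⟨T (g y), ⟨y, hy, rfl⟩, ?_⟩
  have hvy' : ‖S (v - g y)‖ < ε ^ 2 / (2 * M + 1) := by
    rw [map_sub, hgS hy, ← dist_eq_norm]; exact hvy
  have hn : ‖v - g y‖ ≤ 2 := by
    have h1 := mem_closedBall_zero_iff.1 hv
    have h2 := mem_closedBall_zero_iff.1 (hg hy)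
    linarith [norm_sub_le v (g y)]
  rw [Metric.mem_ball, dist_eq_norm, ← map_sub]
  have h3 := h (v - g y)
  have h4 : M * ‖S (v - g y)‖ * ‖v - g y‖ ≤ M * (ε ^ 2 / (2 * M + 1)) * 2 := by gcongr
  have h5 : M * (ε ^ 2 / (2 * M + 1)) * 2 < ε ^ 2 := by
    rw [mul_div_assoc', div_mul_eq_mul_div, div_lt_iff₀ (by positivity)]
    nlinarith [pow_pos hε 2]
  exact lt_of_pow_lt_pow_left₀ 2 hε.le (h3.trans_lt (h4.trans_lt h5))

theorem isCompactOperator_adjoint {T : H →L[ℂ] H} (hT : IsCompactOperator T) :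
    IsCompactOperator (adjoint T) := by
  refine isCompactOperator_of_le (S := T ∘L adjoint T) (M := 1) (hT.comp_clm (adjoint T))
    zero_le_one fun v => ?_
  rw [one_mul, ← @inner_self_eq_norm_sq ℂ, adjoint_inner_left]
  exact (RCLike.re_le_norm _).trans ((norm_inner_le_norm _ _).trans (mul_comm _ _).le)

/-- `C + K(H)` for a unital *-subalgebra `C` of `B(H)`, where `K(H)` denotes the compact
operators. -/
def addCompacts (C : StarSubalgebra ℂ (H →L[ℂ] H)) : StarSubalgebra ℂ (H →L[ℂ] H) where
  carrier := {x | ∃ c ∈ C, ∃ k : H →L[ℂ] H, IsCompactOperator k ∧ x = c + k}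
  mul_mem' := by
    rintro _ _ ⟨c, hc, k, hk, rfl⟩ ⟨c', hc', k', hk', rfl⟩
    exact ⟨c * c', mul_mem hc hc', c * k' + k * (c' + k'),
      (hk'.clm_comp c).add (hk.comp_clm (c' + k')), by noncomm_ring⟩
  add_mem' := by
    rintro _ _ ⟨c, hc, k, hk, rfl⟩ ⟨c', hc', k', hk', rfl⟩
    exact ⟨c + c', add_mem hc hc', k + k', hk.add hk', by abel⟩
  algebraMap_mem' z := ⟨algebraMap ℂ _ z, algebraMap_mem C z, 0, isCompactOperator_zero, by simp⟩
  star_mem' := by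
    rintro _ ⟨c, hc, k, hk, rfl⟩
    exact ⟨star c, star_mem hc, star k, isCompactOperator_adjoint hk, star_add c k⟩

theorem mem_addCompacts {C : StarSubalgebra ℂ (H →L[ℂ] H)} {x : H →L[ℂ] H} :
    x ∈ addCompacts C ↔ ∃ c ∈ C, ∃ k : H →L[ℂ] H, IsCompactOperator k ∧ x = c + k := Iff.rfl

theorem le_addCompacts (C : StarSubalgebra ℂ (H →L[ℂ] H)) : C ≤ addCompacts C :=
  fun c hc => ⟨c, hc, 0, isCompactOperator_zero, (add_zero c).symm⟩

theorem addCompacts_mono {C C' : StarSubalgebra ℂ (H →L[ℂ] H)} (h : C ≤ C') :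
    addCompacts C ≤ addCompacts C' := by
  rintro _ ⟨c, hc, k, hk, rfl⟩
  exact ⟨c, h hc, k, hk, rfl⟩

/-- A selfadjoint `c ∈ C` at distance less than `s` from the compact operators is, up to a compact
element of `C`, of norm at most `s`. -/
theorem exists_compact_mem {C : StarSubalgebra ℂ (H →L[ℂ] H)} (hC : IsClosed (C : Set (H →L[ℂ] H)))
    {c k : H →L[ℂ] H} (hc : c ∈ C) (hsa : IsSelfAdjoint c) (hk : IsCompactOperator k) {s : ℝ}
    (hs : ‖c + k‖ < s) : ∃ y ∈ C, IsCompactOperator y ∧ ‖c - y‖ ≤ s := by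
  have hs0 : 0 < s := (norm_nonneg _).trans_lt hs
  let f : ℝ → ℝ := fun t => max (-s) (min s t)
  have hf : Continuous f := by fun_prop
  let g : ℝ → ℝ := fun t => t - f t
  have hg : Continuous g := continuous_id.sub hf
  have hgm : cfc g c ∈ C := by
    have := hC
    exact cfc_mem (𝕜' := ℂ) (s := C) g hc
  have hsub : c - cfc g c = cfc f c := by
    have : cfc (fun t : ℝ => t - g t) c = c - cfc g c := by
      rw [cfc_sub (fun t : ℝ => t) g c (by fun_prop) hg.continuousOn, cfc_id' ℝ c]
    rw [← this]
    congr 1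
    funext t
    simp [g]
  refine ⟨cfc g c, hgm, ?_, ?_⟩
  · let h : ℝ → ℝ := fun t => t / max (t ^ 2) (s ^ 2)
    have hpos : ∀ t : ℝ, 0 < max (t ^ 2) (s ^ 2) := fun t => lt_max_of_lt_right (by positivity)
    have hh : Continuous h := by
      refine Continuous.div (by fun_prop) (by fun_prop) fun t => (hpos t).ne'
    have hhs : ‖cfc h c‖ ≤ 1 / s := by
      refine norm_cfc_le (by positivity) fun t _ => ?_
      rw [Real.norm_eq_abs, abs_div, abs_of_pos (hpos t), div_le_div_iff₀ (hpos t) hs0, one_mul]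
      rcases le_total |t| s with hts | hts
      · refine le_max_of_le_right ?_
        rw [sq]; exact mul_le_mul_of_nonneg_right hts hs0.le
      · refine le_max_of_le_left ?_
        rw [← sq_abs, sq]; exact mul_le_mul_of_nonneg_left hts (abs_nonneg t)
    have hgh : cfc g c = cfc h c * (c * cfc g c) := by
      have e1 : cfc (fun t : ℝ => t * g t) c = c * cfc g c := by
        rw [cfc_mul (fun t : ℝ => t) g c (by fun_prop) hg.continuousOn, cfc_id' ℝ c]
      rw [← e1, ← cfc_mul h (fun t => t * g t) c hh.continuousOn
        (continuous_id.mul hg).continuousOn]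
      congr 1
      funext t
      change g t = t / max (t ^ 2) (s ^ 2) * (t * g t)
      rcases lt_or_ge |t| s with hts | hts
      · have hg0 : g t = 0 := by
          have := abs_lt.1 hts
          simp only [g, f]
          rw [min_eq_right this.2.le, max_eq_right this.1.le, sub_self]
        rw [hg0]; simp
      · have h2 : s ^ 2 ≤ t ^ 2 := by
          rw [← sq_abs t]; exact pow_le_pow_left₀ hs0.le hts 2
        have ht2 : t ≠ 0 := by
          rintro rfl
          rw [abs_zero] at hts
          exact absurd hts (not_le.2 hs0)
        rw [max_eq_left h2]
        field_simp
    set y := cfc g c with hy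
    have hky : IsCompactOperator (k ∘L y) := hk.comp_clm y
    have hsr : 0 < s - ‖c + k‖ := sub_pos.2 hs
    refine isCompactOperator_of_le hky (M := ‖y‖ / (s - ‖c + k‖)) (by positivity) fun v => ?_
    have h1 : s * ‖y v‖ ≤ ‖c (y v)‖ := by
      have e : y v = cfc h c (c (y v)) := congrArg (fun T : H →L[ℂ] H => T v) hgh
      have := (le_opNorm (cfc h c) (c (y v))).trans
        (mul_le_mul_of_nonneg_right hhs (norm_nonneg _))
      rw [← e, one_div, inv_mul_eq_div, le_div_iff₀ hs0] at this
      linarith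
    have h2 : ‖c (y v)‖ ≤ ‖c + k‖ * ‖y v‖ + ‖k (y v)‖ := by
      have e : c (y v) = (c + k) (y v) - k (y v) := by simp
      rw [e]
      exact (norm_sub_le _ _).trans (add_le_add_left (le_opNorm (c + k) (y v)) _)
    have h3 : (s - ‖c + k‖) * ‖y v‖ ≤ ‖k (y v)‖ := by linarith
    have h4 : ‖y v‖ ≤ ‖y‖ * ‖v‖ := le_opNorm y v
    change ‖y v‖ ^ 2 ≤ ‖y‖ / (s - ‖c + k‖) * ‖k (y v)‖ * ‖v‖
    rw [div_mul_eq_mul_div, div_mul_eq_mul_div, le_div_iff₀ hsr]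
    calc ‖y v‖ ^ 2 * (s - ‖c + k‖) = ((s - ‖c + k‖) * ‖y v‖) * ‖y v‖ := by ring
      _ ≤ ‖k (y v)‖ * (‖y‖ * ‖v‖) :=
        mul_le_mul h3 h4 (norm_nonneg _) (norm_nonneg _)
      _ = ‖y‖ * ‖k (y v)‖ * ‖v‖ := by ring
  · rw [hsub]
    refine norm_cfc_le hs0.le fun t _ => ?_
    rw [Real.norm_eq_abs, abs_le]
    exact ⟨le_max_left _ _, max_le (by linarith) (min_le_left _ _)⟩

/-- Every element of `C + K(H)` has a decomposition in which the first summand is controlled. -/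
theorem exists_controlled {C : StarSubalgebra ℂ (H →L[ℂ] H)}
    (hC : IsClosed (C : Set (H →L[ℂ] H))) {c k : H →L[ℂ] H} (hc : c ∈ C)
    (hk : IsCompactOperator k) : ∃ c' ∈ C, ∃ k' : H →L[ℂ] H, IsCompactOperator k' ∧
      c' + k' = c + k ∧ ‖c'‖ ≤ 4 * ‖c + k‖ := by
  by_cases h0 : c + k = 0
  · exact ⟨0, zero_mem C, 0, isCompactOperator_zero, by rw [h0, add_zero], by simp [h0]⟩
  have hx : 0 < ‖c + k‖ := norm_pos_iff.2 h0
  have key : ∀ d ∈ C, IsSelfAdjoint d → ∀ m : H →L[ℂ] H, IsCompactOperator m →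
      ‖d + m‖ ≤ ‖c + k‖ → ∃ y ∈ C, IsCompactOperator y ∧ ‖d - y‖ ≤ 2 * ‖c + k‖ :=
    fun d hd hds m hm hle => exists_compact_mem hC hd hds hm (by linarith)
  have hk' : IsCompactOperator (star k : H →L[ℂ] H) := isCompactOperator_adjoint hk
  have hre : ‖(realPart c : H →L[ℂ] H) + (realPart k : H →L[ℂ] H)‖ ≤ ‖c + k‖ := by
    have := realPart.norm_le (c + k)
    rw [map_add] at this
    exact this
  have him : ‖(imaginaryPart c : H →L[ℂ] H) + (imaginaryPart k : H →L[ℂ] H)‖ ≤ ‖c + k‖ := by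
    have := imaginaryPart.norm_le (c + k)
    rw [map_add] at this
    exact this
  have hkre : IsCompactOperator (realPart k : H →L[ℂ] H) := by
    rw [realPart_apply_coe]
    exact (hk.add hk').smul _
  have hkim : IsCompactOperator (imaginaryPart k : H →L[ℂ] H) := by
    rw [imaginaryPart_apply_coe]
    exact ((hk.sub hk').smul _).smul _
  have hcre : (realPart c : H →L[ℂ] H) ∈ C := by
    rw [realPart_apply_coe, ← Complex.coe_smul]
    exact SMulMemClass.smul_mem _ (add_mem hc (star_mem hc))
  have hcim : (imaginaryPart c : H →L[ℂ] H) ∈ C := by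
    rw [imaginaryPart_apply_coe, ← Complex.coe_smul]
    exact SMulMemClass.smul_mem _ (SMulMemClass.smul_mem _ (sub_mem hc (star_mem hc)))
  obtain ⟨y, hy, hyk, hyn⟩ := key _ hcre (realPart c).2 _ hkre hre
  obtain ⟨z, hz, hzk, hzn⟩ := key _ hcim (imaginaryPart c).2 _ hkim him
  have hdec := realPart_add_I_smul_imaginaryPart c
  refine ⟨c - (y + I • z), sub_mem hc (add_mem hy (SMulMemClass.smul_mem _ hz)),
    k + (y + I • z), hk.add (hyk.add (hzk.smul I)), by abel, ?_⟩
  have e : c - (y + I • z) = ((realPart c : H →L[ℂ] H) - y)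
      + I • ((imaginaryPart c : H →L[ℂ] H) - z) := by
    nth_rewrite 1 [← hdec]
    rw [smul_sub]; abel
  rw [e]
  refine (norm_add_le _ _).trans ?_
  rw [norm_smul, norm_I, one_mul]
  linarith

/-- `C + K(H)` is norm closed if `C` is, hence it is a C*-algebra. -/
theorem isClosed_addCompacts {C : StarSubalgebra ℂ (H →L[ℂ] H)}
    (hC : IsClosed (C : Set (H →L[ℂ] H))) :
    IsClosed (addCompacts C : Set (H →L[ℂ] H)) := by
  let M : Submodule ℂ (H →L[ℂ] H) := Subalgebra.toSubmodule C.toSubalgebra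
  let N : Submodule ℂ (H →L[ℂ] H) :=
    { carrier := {k | IsCompactOperator k}
      add_mem' := fun h h' => h.add h'
      zero_mem' := isCompactOperator_zero
      smul_mem' := fun z _ h => h.smul z }
  have hM : IsClosed (M : Set (H →L[ℂ] H)) := hC
  have hN : IsClosed (N : Set (H →L[ℂ] H)) := isClosed_setOfPred_isCompactOperator
  have : CompleteSpace M := hM.completeSpace_coe
  have : CompleteSpace N := hN.completeSpace_coe
  let f : NormedAddGroupHom (M × N) (H →L[ℂ] H) :=
    AddMonoidHom.mkNormedAddGroupHom
      ((M.subtypeL.coprod N.subtypeL : M × N →L[ℂ] (H →L[ℂ] H)) : M × N →+ (H →L[ℂ] H))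
      ‖(M.subtypeL.coprod N.subtypeL : M × N →L[ℂ] (H →L[ℂ] H))‖ (le_opNorm _)
  have hf : ∀ q : M × N, f q = (q.1 : H →L[ℂ] H) + (q.2 : H →L[ℂ] H) := fun q => rfl
  have hsurj : f.SurjectiveOnWith f.range 5 := by
    rintro _ ⟨⟨⟨c, hc⟩, ⟨k, hk⟩⟩, rfl⟩
    obtain ⟨c', hc', k', hk', he, hn⟩ := exists_controlled hC hc hk
    refine ⟨(⟨c', hc'⟩, ⟨k', hk'⟩), he, ?_⟩
    change ‖((⟨c', hc'⟩, ⟨k', hk'⟩) : M × N)‖ ≤ 5 * ‖c + k‖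
    rw [Prod.norm_def]
    refine max_le ?_ ?_
    · change ‖c'‖ ≤ _
      linarith [norm_nonneg (c + k)]
    · change ‖k'‖ ≤ _
      have : k' = (c + k) - c' := by rw [← he]; abel
      rw [this]
      linarith [norm_sub_le (c + k) c']
  have hcl := controlled_closure_of_complete (by norm_num) one_pos hsurj
  refine isClosed_of_closure_subset fun x hx => ?_
  have hx' : x ∈ f.range.topologicalClosure := by
    refine closure_mono ?_ hx
    rintro _ ⟨c, hc, k, hk, rfl⟩
    exact ⟨(⟨c, hc⟩, ⟨k, hk⟩), rfl⟩
  obtain ⟨⟨⟨c, hc⟩, ⟨k, hk⟩⟩, hg, -⟩ := hcl x hx'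
  exact ⟨c, hc, k, hk, hg.symm⟩

instance isClosed_addCompacts' (C : StarSubalgebra ℂ (H →L[ℂ] H)) [hC : IsClosed (C : Set (H →L[ℂ] H))] :
    IsClosed (addCompacts C : Set (H →L[ℂ] H)) := isClosed_addCompacts hC

instance isClosed_bot : IsClosed ((⊥ : StarSubalgebra ℂ (H →L[ℂ] H)) : Set (H →L[ℂ] H)) := by
  have h : ((⊥ : StarSubalgebra ℂ (H →L[ℂ] H)) : Set (H →L[ℂ] H))
      = (Submodule.span ℂ {(1 : H →L[ℂ] H)} : Submodule ℂ (H →L[ℂ] H)) := by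
    ext x
    rw [SetLike.mem_coe, SetLike.mem_coe, StarSubalgebra.mem_bot, Submodule.mem_span_singleton]
    simp only [Set.mem_range, Algebra.algebraMap_eq_smul_one]
  rw [h]
  exact Submodule.closed_of_finiteDimensional _

end CompactPerturbation

/-! ### The inclusions of the example -/

namespace NonInjective

open CompactPerturbation

variable {H : Type*} [NormedAddCommGroup H] [InnerProductSpace ℂ H] [CompleteSpace H]

variable (H) in
/-- The C*-algebra `A = ℂ1 + K(H)`. -/
abbrev A : StarSubalgebra ℂ (H →L[ℂ] H) := addCompacts ⊥

/-- The C*-algebra `D̃ = C*(u)` generated by `u` and the identity (which already lies in the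
C*-algebra generated by `u` when `u` is unitary). -/
abbrev Dt (u : H →L[ℂ] H) : StarSubalgebra ℂ (H →L[ℂ] H) := StarAlgebra.elemental ℂ u

instance (u : H →L[ℂ] H) : IsClosed (Dt u : Set (H →L[ℂ] H)) :=
  StarAlgebra.elemental.isClosed ℂ u

/-- The C*-algebra `Ã = C*(u) + K(H)`. -/
abbrev At (u : H →L[ℂ] H) : StarSubalgebra ℂ (H →L[ℂ] H) := addCompacts (Dt u)

/-- The C*-algebra `B̃ = B ⊗ D̃`. -/
abbrev Bt (u : H →L[ℂ] H) (B : Type*) [CStarAlgebra B] : Type _ := CStarTensor B (Dt u)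

/-- The unital inclusion `z ↦ z 1` of `D = ℂ` into a unital C*-algebra. -/
def scalars (R : Type*) [CStarAlgebra R] : ℂ →⋆ₙₐ[ℂ] R := (StarAlgHom.ofId ℂ R).toNonUnitalStarAlgHom

/-- The inclusion `A ⊆ Ã`. -/
def inclA (u : H →L[ℂ] H) : A H →⋆ₙₐ[ℂ] At u :=
  (StarSubalgebra.inclusion (addCompacts_mono bot_le)).toNonUnitalStarAlgHom

/-- The inclusion `D̃ ⊆ Ã`. -/
def inclDt (u : H →L[ℂ] H) : Dt u →⋆ₙₐ[ℂ] At u :=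
  (StarSubalgebra.inclusion (le_addCompacts (Dt u))).toNonUnitalStarAlgHom

theorem inclA_scalars (u : H →L[ℂ] H) (z : ℂ) :
    inclA u (scalars (A H) z) = inclDt u (scalars (Dt u) z) := rfl

theorem inclLeft_scalars (u : H →L[ℂ] H) (B : Type*) [CStarAlgebra B] (z : ℂ) :
    CStarTensor.inclLeft B (Dt u) (scalars B z) =
      CStarTensor.inclRight B (Dt u) (scalars (Dt u) z) := by
  refine congrArg (CStarTensor.ofAlg B (Dt u)) ?_
  change (algebraMap ℂ B z) ⊗ₜ[ℂ] (1 : Dt u) = (1 : B) ⊗ₜ[ℂ] (algebraMap ℂ (Dt u) z)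
  rw [Algebra.algebraMap_eq_smul_one, Algebra.algebraMap_eq_smul_one, TensorProduct.smul_tmul]

/-- The *-homomorphism `λ : A *_D B → Ã *_D̃ B̃` arising from the inclusions `D = ℂ ⊆ D̃`, `A ⊆ Ã`
and `B ⊆ B ⊗ D̃`, `b ↦ b ⊗ 1`, where `D̃` is contained in `Ã` and, by `d ↦ 1 ⊗ d`, in `B ⊗ D̃`. -/
def lam (u : H →L[ℂ] H) (B : Type*) [CStarAlgebra B] :
    FullAmalgFreeProduct (scalars (A H)) (scalars B) →⋆ₙₐ[ℂ]
      FullAmalgFreeProduct (inclDt u) (CStarTensor.inclRight B (Dt u)) :=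
  FullAmalgFreeProduct.map (scalars (Dt u)) (inclA u) (CStarTensor.inclLeft B (Dt u))
    (inclA_scalars u) (inclLeft_scalars u B)

end NonInjective

end

/-! In `Ã *_D̃ B̃` the operator `u` lies in `D̃`, where it is identified with `1 ⊗ u`, so it
commutes with every `b ⊗ 1`. The algebra `A` need not contain `u`, but the compacts form an ideal,
so `A` contains `k u` and `u k'` for compact `k`, `k'`. Hence `x = k b (u k') - (k u) b k'` makes
sense in `A *_ℂ B`, and `λ` sends it to `k (b u - u b) k' = 0` (`lam_commutatorElement`).

It remains to find `k`, `k'`, `b` with `x ≠ 0` (`exists_commutatorElement_ne_zero`). Since the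
amalgamation upstairs is only over the scalars, any two unital representations of `A` and `B` on one
Hilbert space define a representation of `A *_ℂ B`. Take a representation `ρ` of `B` on `L` and a
selfadjoint `b` with `ρ b` not scalar (`exists_representation`, by GNS). On `H ⊗ L` let `A` act by
`a ⊗ 1`, and let `B` act by `1 ⊗ ρ` conjugated by a unitary `W`. By
`exists_unitary_conj_not_commute`, `W` can be chosen so that the image `S` of `b` does not commute
with `u ⊗ 1`. The compacts act non-degenerately on `H ⊗ L`, so rank one `k`, `k'` exist with `(k ⊗
1) (S (u ⊗ 1) - (u ⊗ 1) S) (k' ⊗ 1) ≠ 0` (`exists_rankOne_mul_mul_ne_zero`). This operator is the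
image of `x`. -/

open scoped TensorProduct

noncomputable section

/-! ### Unitary conjugates of non-scalar operators -/

namespace ContinuousLinearMap

open InnerProductSpace Complex

variable {M : Type*} [NormedAddCommGroup M] [InnerProductSpace ℂ M]

/-- Used in contrapositive form: a non-scalar operator has a vector that is not an eigenvector, and
from it `exists_orthonormal_pair` is built. -/
theorem exists_smul_one_of_forall_eigenvector {T : M →L[ℂ] M} (h : ∀ x, ∃ c : ℂ, T x = c • x) :
    ∃ c : ℂ, T = c • 1 := by
  obtain ⟨c, hc⟩ := LinearMap.exists_eq_smul_id_of_forall_notLinearIndependent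
    (f := (T : M →ₗ[ℂ] M)) fun v hv => by
      obtain ⟨c, hc⟩ := h v
      exact one_ne_zero (neg_eq_zero.1 (LinearIndependent.pair_iff.1 hv c (-1) (by simp [hc])).2)
  exact ⟨c, ContinuousLinearMap.ext fun x => LinearMap.congr_fun hc x⟩

/-- A non-scalar operator maps some unit vector out of its span. -/
theorem exists_orthonormal_pair {T : M →L[ℂ] M} (hT : ∀ c : ℂ, T ≠ c • 1) :
    ∃ f g : M, ∃ α : ℂ, ∃ β : ℝ, ‖f‖ = 1 ∧ ‖g‖ = 1 ∧ inner ℂ f g = (0 : ℂ) ∧ 0 < β ∧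
      T f = α • f + (β : ℂ) • g := by
  obtain ⟨x, hx⟩ : ∃ x, ∀ c : ℂ, T x ≠ c • x := by
    by_contra! h
    obtain ⟨c, hc⟩ := exists_smul_one_of_forall_eigenvector h
    exact hT c hc
  have hx0 : x ≠ 0 := by rintro rfl; exact hx 0 (by simp)
  have hn : (‖x‖ : ℂ) ≠ 0 := by simpa using hx0
  set f : M := (‖x‖ : ℂ)⁻¹ • x with hf
  have hxf : x = (‖x‖ : ℂ) • f := by rw [hf, smul_smul, mul_inv_cancel₀ hn, one_smul]
  have hf1 : ‖f‖ = 1 := by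
    rw [hf, norm_smul, norm_inv, norm_real, norm_norm, inv_mul_cancel₀ (norm_ne_zero_iff.2 hx0)]
  -- Gram–Schmidt on `f`, `T f`: the remainder `r` is orthogonal to `f`, and it is nonzero because
  -- `f` is not an eigenvector. Normalising `r` gives `g`, with `β = ‖r‖`.
  set α : ℂ := inner ℂ f (T f) with hα
  set r : M := T f - α • f with hr
  have hr0 : r ≠ 0 := by
    intro h
    rw [hr, sub_eq_zero] at h
    refine hx α ?_
    rw [hxf, map_smul, h, smul_comm]
  have hrn : (‖r‖ : ℂ) ≠ 0 := by simpa using hr0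
  have hfr : inner ℂ f r = (0 : ℂ) := by
    rw [hr, inner_sub_right, inner_smul_right, inner_self_eq_one_of_norm_eq_one hf1, mul_one,
      ← hα, sub_self]
  refine ⟨f, (‖r‖ : ℂ)⁻¹ • r, α, ‖r‖, hf1, ?_, ?_, norm_pos_iff.2 hr0, ?_⟩
  · rw [norm_smul, norm_inv, norm_real, norm_norm, inv_mul_cancel₀ (norm_ne_zero_iff.2 hr0)]
  · rw [inner_smul_right, hfr, mul_zero]
  · rw [smul_inv_smul₀ hrn, hr]; abel

variable [CompleteSpace M]

/-- A complex Householder transformation: a unitary taking a unit vector to another one and fixing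
the orthogonal complement of their difference. -/
theorem exists_unitary_map_eq {v w : M} (hv : ‖v‖ = 1) (hw : ‖w‖ = 1) :
    ∃ W ∈ unitary (M →L[ℂ] M), W v = w ∧ ∀ z, inner ℂ (v - w) z = 0 → W z = z := by
  by_cases hvw : v = w
  · exact ⟨1, one_mem _, hvw, fun z _ => rfl⟩
  set a := v - w with ha
  have hvv : inner ℂ v v = (1 : ℂ) := inner_self_eq_one_of_norm_eq_one hv
  have hww : inner ℂ w w = (1 : ℂ) := inner_self_eq_one_of_norm_eq_one hw
  -- The reflection will be `1 - s⁻¹ P` with `P z = ⟨a, z⟩ a`. The coefficient `s⁻¹` is forced by `v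
  -- ↦ v - a = w`. It is complex since `⟨w, v⟩` need not be real, and `s ≠ 0` is the equality case
  -- of Cauchy–Schwarz.
  set s : ℂ := inner ℂ a v with hs
  have hs' : s = 1 - inner ℂ w v := by rw [hs, ha, inner_sub_left, hvv]
  have hs0 : s ≠ 0 := by
    intro h
    rw [hs', sub_eq_zero] at h
    exact hvw ((inner_eq_one_iff_of_norm_eq_one hw hv).1 h.symm).symm
  have haa : inner ℂ a a = s + star s := by
    rw [hs', star_sub, star_one, ha, inner_sub_left, inner_sub_right, inner_sub_right, hvv, hww,
      ← inner_conj_symm v w]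
    simp only [starRingEnd_apply]
    ring
  have hss : star s ≠ 0 := star_ne_zero.2 hs0
  let P : M →L[ℂ] M := rankOne ℂ a a
  have hP : ∀ z, P z = (inner ℂ a z : ℂ) • a := fun z => rankOne_apply a a z
  have hPs : star P = P := by
    change adjoint P = P
    exact adjoint_rankOne a a
  have hPP : P * P = (s + star s) • P := by
    ext z
    simp only [mul_apply_eq_comp, hP, smul_apply, inner_smul_right, haa, smul_smul, mul_comm]
  have hW : star (1 - s⁻¹ • P) = 1 - (star s)⁻¹ • P := by
    rw [star_sub, star_one, star_smul, hPs, star_inv₀]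
  refine ⟨1 - s⁻¹ • P, Unitary.mem_iff.2 ⟨?_, ?_⟩, ?_, fun z hz => ?_⟩
  -- Unitarity comes down to `‖a‖² = s + star s`: this makes the coefficient of the `P²` term equal
  -- to the sum of the two linear ones, so all multiples of `P` cancel.
  · rw [hW, sub_mul, mul_sub, mul_sub, one_mul, mul_one, one_mul, smul_mul_smul_comm, hPP,
      smul_smul]
    have : (star s)⁻¹ * s⁻¹ * (s + star s) = (star s)⁻¹ + s⁻¹ := by field_simp
    rw [this, add_smul]; abel
  · rw [hW, sub_mul, mul_sub, mul_sub, one_mul, mul_one, one_mul, smul_mul_smul_comm, hPP,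
      smul_smul]
    have : s⁻¹ * (star s)⁻¹ * (s + star s) = (star s)⁻¹ + s⁻¹ := by field_simp
    rw [this, add_smul]; abel
  · change v - s⁻¹ • P v = w
    rw [hP, smul_smul, ← hs, inv_mul_cancel₀ hs0, one_smul, ha, sub_sub_cancel]
  · change z - s⁻¹ • P z = z
    rw [hP, hz, zero_smul, smul_zero, sub_zero]

/-- Two orthonormal pairs are unitarily equivalent. -/
theorem exists_unitary_map_pair {f g e e' : M} (hf : ‖f‖ = 1) (hg : ‖g‖ = 1)
    (hfg : inner ℂ f g = (0 : ℂ)) (he : ‖e‖ = 1) (he' : ‖e'‖ = 1) (hee : inner ℂ e e' = (0 : ℂ)) :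
    ∃ W ∈ unitary (M →L[ℂ] M), W f = e ∧ W g = e' := by
  obtain ⟨V, hV, hVf, -⟩ := exists_unitary_map_eq hf he
  have hVi : ∀ x y, inner ℂ (V x) (V y) = (inner ℂ x y : ℂ) := fun x y => by
    rw [← adjoint_inner_right]
    change inner ℂ x ((star V * V) y) = _
    rw [Unitary.star_mul_self_of_mem hV]; rfl
  have hVg : ‖V g‖ = 1 := by
    rw [norm_eq_sqrt_re_inner (𝕜 := ℂ), hVi, ← norm_eq_sqrt_re_inner, hg]
  -- Both `V g` and `e'` are orthogonal to `e = V f`, so the second reflection leaves `e` where the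
  -- first one put it.
  obtain ⟨R, hR, hRg, hRz⟩ := exists_unitary_map_eq hVg he'
  refine ⟨R * V, mul_mem hR hV, ?_, hRg⟩
  change R (V f) = e
  rw [hVf]
  refine hRz e ?_
  have h1 : inner ℂ (V g) e = (0 : ℂ) := by
    rw [← hVf, hVi]; exact inner_eq_zero_symm.1 hfg
  rw [inner_sub_left, h1, inner_eq_zero_symm.1 hee, sub_zero]

/-- Some unitary conjugate of a non-scalar selfadjoint operator does not commute with a given
non-scalar operator. -/
theorem exists_unitary_conj_not_commute {T U : M →L[ℂ] M} (hTs : star T = T)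
    (hT : ∀ c : ℂ, T ≠ c • 1) (hU : ∀ c : ℂ, U ≠ c • 1) :
    ∃ W ∈ unitary (M →L[ℂ] M), ¬ Commute (W * T * star W) U := by
  obtain ⟨f, g, α, β, hf, hg, hfg, hβ, hTf⟩ := exists_orthonormal_pair hT
  obtain ⟨e, e', α', β', he, he', hee, hβ', hUe⟩ := exists_orthonormal_pair hU
  by_contra! hcom
  have hne : inner ℂ e e = (1 : ℂ) := inner_self_eq_one_of_norm_eq_one he
  have hne' : inner ℂ e' e' = (1 : ℂ) := inner_self_eq_one_of_norm_eq_one he'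
  -- The phase `θ` is the freedom left in `W`: `f ↦ e`, `g ↦ θ e'`. With `S = W T W*`, commutation
  -- gives `⟨S e, U e⟩ = ⟨e, U S e⟩`. The two sides depend on `θ` through `star θ` and `θ`
  -- respectively, which cannot agree for all phases.
  have key : ∀ θ : ℂ, ‖θ‖ = 1 → (β' : ℂ) * star θ = θ * inner ℂ e (U e') := by
    intro θ hθ
    obtain ⟨W, hW, hWf, hWg⟩ := exists_unitary_map_pair hf hg hfg he
      (e' := θ • e') (by rw [norm_smul, hθ, he', one_mul])
      (by rw [inner_smul_right, hee, mul_zero])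
    set S := W * T * star W with hS
    have hSs : star S = S := by
      rw [hS, star_mul, star_mul, star_star, hTs, mul_assoc]
    have hSi : ∀ x y, (inner ℂ x (S y) : ℂ) = inner ℂ (S x) y := fun x y => by
      rw [← adjoint_inner_left]
      exact congrArg (fun Z : M →L[ℂ] M => (inner ℂ (Z x) y : ℂ)) hSs
    have hWe : star W e = f := by
      rw [← hWf]
      exact congrArg (fun Z : M →L[ℂ] M => Z f) (Unitary.star_mul_self_of_mem hW)
    have hSe : S e = α • e + ((β : ℂ) * θ) • e' := by
      change W (T (star W e)) = _
      rw [hWe, hTf, map_add, map_smul, map_smul, hWf, hWg, smul_smul]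
    have hc : S (U e) = U (S e) :=
      congrArg (fun Z : M →L[ℂ] M => Z e) (hcom W hW).eq
    have h1 : (inner ℂ e (S (U e)) : ℂ) = inner ℂ e (U (S e)) := by rw [hc]
    -- Computing `⟨e, S e⟩` in two ways shows that `α` is real, so the terms in `α α'` drop out of
    -- `h1`.
    have hα : (inner ℂ e (S e) : ℂ) = star α := by
      rw [hSi, hSe, inner_add_left, inner_smul_left, inner_smul_left, hne,
        inner_eq_zero_symm.1 hee]
      simp
    have hα' : (inner ℂ e (S e) : ℂ) = α := by
      rw [hSe, inner_add_right, inner_smul_right, inner_smul_right, hne, hee]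
      simp
    rw [hSi, hSe, hUe, map_add, map_smul, map_smul, hUe] at h1
    simp only [inner_add_left, inner_add_right, inner_smul_left, inner_smul_right, hne, hne', hee,
      inner_eq_zero_symm.1 hee, starRingEnd_apply, star_mul', mul_zero, add_zero,
      zero_add, mul_one] at h1
    have hb : star (β : ℂ) = β := conj_ofReal β
    rw [hb] at h1
    have hβ0 : (β : ℂ) ≠ 0 := ofReal_ne_zero.2 hβ.ne'
    refine mul_left_cancel₀ hβ0 ?_
    linear_combination h1 + α' * hα - α' * hα'
  -- The phase `1` gives `⟨e, U e'⟩ = β'`; the phase `I` gives `-I β' = I ⟨e, U e'⟩`. Together they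
  -- force `β' = 0`.
  have k1 := key 1 norm_one
  have k2 := key I norm_I
  rw [star_one, mul_one, one_mul] at k1
  have hI : star I = -I := conj_I
  rw [← k1, hI] at k2
  have h3 : (β' : ℂ) * I = 0 := by linear_combination (-1 / 2 : ℂ) * k2
  exact (mul_ne_zero (ofReal_ne_zero.2 hβ'.ne') I_ne_zero) h3

end ContinuousLinearMap

/-! ### Positive functionals and a GNS representation with non-scalar image -/

namespace CStarAlgebra

open scoped ComplexOrder ComplexStarModule
open Complex

section

variable {B : Type*} [CStarAlgebra B] [PartialOrder B] [StarOrderedRing B]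

/-- The positive elements of a C*-algebra, as a closed cone. -/
def nonnegCone (B : Type*) [CStarAlgebra B] [PartialOrder B] [StarOrderedRing B] :
    ProperCone ℝ B where
  carrier := {b | 0 ≤ b}
  add_mem' := fun ha hb => add_nonneg ha hb
  zero_mem' := le_refl (0 : B)
  smul_mem' := fun c _ ha => smul_nonneg (α := ℝ) c.2 ha
  isClosed' := isClosed_nonneg

/-- A nonzero positive element is detected by a positive functional. -/
theorem exists_positiveLinearMap_pos {c : B} (hc : 0 ≤ c) (hc0 : c ≠ 0) :
    ∃ φ : B →ₚ[ℂ] ℂ, 0 < φ c := by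
  -- The positive cone meets its negative only in `0`. Separating `-c` from it yields a real
  -- functional that is nonnegative on the cone and negative at `-c`.
  have hn : -c ∉ nonnegCone B := fun h => hc0 (le_antisymm (neg_nonneg.1 h) hc)
  obtain ⟨f, hf, hfc⟩ := (nonnegCone B).hyperplane_separation_point hn
  -- The complex-linear functional built from the restriction of `f` to selfadjoint elements; on
  -- positive elements it agrees with `f`.
  let φ : B →ₗ[ℂ] ℂ :=
    { toFun := fun x => (f (ℜ x : B) : ℂ) + I * (f (ℑ x : B) : ℂ)
      map_add' := fun x y => by
        simp only [map_add, AddSubgroup.coe_add, ofReal_add]; ring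
      map_smul' := fun z x => by
        simp only [realPart_smul, imaginaryPart_smul, AddSubgroup.coe_add, AddSubgroup.coe_sub,
          selfAdjoint.val_smul, map_add, map_sub, map_smul, smul_eq_mul, ofReal_add, ofReal_sub,
          ofReal_mul, RingHom.id_apply]
        conv_rhs => rw [← re_add_im z]
        linear_combination (-(z.im * f (ℑ x : B)) : ℂ) * I_mul_I }
  have hφ : ∀ x : B, 0 ≤ x → φ x = (f x : ℂ) := fun x hx => by
    change (f (ℜ x : B) : ℂ) + I * (f (ℑ x : B) : ℂ) = f x
    rw [hx.isSelfAdjoint.coe_realPart, hx.isSelfAdjoint.imaginaryPart]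
    simp
  refine ⟨PositiveLinearMap.mk₀ φ fun x hx => ?_, ?_⟩
  · rw [hφ x hx]
    exact Complex.zero_le_real.2 (hf x hx)
  · change 0 < φ c
    rw [hφ c hc]
    rw [map_neg] at hfc
    exact Complex.zero_lt_real.2 (by linarith)

/-- A C*-algebra other than `ℂ` contains two nonzero orthogonal positive elements. -/
theorem exists_orthogonal_nonneg (hB : 1 < Module.rank ℂ B) :
    ∃ c d : B, 0 ≤ c ∧ 0 ≤ d ∧ c ≠ 0 ∧ d ≠ 0 ∧ c * d = 0 := by
  have : Nontrivial B := rank_pos_iff_nontrivial.1 (zero_lt_one.trans hB)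
  -- If all selfadjoint elements were scalar, real and imaginary parts would make every element
  -- scalar. The spectrum of such a `b` has two points, because functional calculus turns a
  -- one-point spectrum into a scalar.
  obtain ⟨b, hb, hbs⟩ : ∃ b : B, IsSelfAdjoint b ∧ ∀ r : ℝ, b ≠ algebraMap ℝ B r := by
    by_contra! h
    refine not_le.2 hB (rank_le_one_iff.2 ⟨1, fun x => ?_⟩)
    obtain ⟨r, hr⟩ := h _ (ℜ x).2
    obtain ⟨s, hs⟩ := h _ (ℑ x).2
    refine ⟨r + I * s, ?_⟩
    conv_rhs => rw [← realPart_add_I_smul_imaginaryPart x, hr, hs]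
    simp only [Algebra.algebraMap_eq_smul_one, add_smul, mul_smul, Complex.coe_smul]
  obtain ⟨s, hs⟩ := ContinuousFunctionalCalculus.spectrum_nonempty (R := ℝ) b hb
  obtain ⟨t, ht, hst⟩ : ∃ t ∈ spectrum ℝ b, t ≠ s := by
    by_contra! h
    refine hbs s ?_
    rw [← cfc_id' ℝ b, ← cfc_const s b]
    exact cfc_congr fun x hx => h x hx
  have key : ∀ g : ℝ → ℝ, Continuous g → ∀ r ∈ spectrum ℝ b, g r ≠ 0 → cfc g b ≠ 0 := by
    intro g hg r hr hgr h0
    have : g r ∈ spectrum ℝ (cfc g b) := by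
      rw [cfc_map_spectrum g b hb hg.continuousOn]
      exact ⟨r, hr, rfl⟩
    rw [h0, spectrum.zero_eq] at this
    exact hgr this
  wlog hlt : s < t generalizing s t
  · exact this t ht s hs hst.symm (lt_of_le_of_ne (not_lt.1 hlt) hst)
  -- The wanted pair is the positive and the negative part of `b - m`. As `m` separates `s` from
  -- `t`, each part has a nonzero spectral value.
  let m := (s + t) / 2
  have hg : Continuous fun x : ℝ => max (x - m) 0 := by fun_prop
  have hh : Continuous fun x : ℝ => max (m - x) 0 := by fun_prop
  refine ⟨cfc (fun x : ℝ => max (x - m) 0) b, cfc (fun x : ℝ => max (m - x) 0) b,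
    cfc_nonneg fun x _ => le_max_right _ _, cfc_nonneg fun x _ => le_max_right _ _,
    key _ hg t ht ?_, key _ hh s hs ?_, ?_⟩
  · exact (lt_max_of_lt_left (by simp only [m]; linarith)).ne'
  · exact (lt_max_of_lt_left (by simp only [m]; linarith)).ne'
  · rw [← cfc_mul _ _ b hg.continuousOn hh.continuousOn, ← cfc_const_zero ℝ b]
    refine cfc_congr fun x _ => ?_
    rcases le_total x m with h | h
    · simp [max_eq_right (sub_nonpos.2 h)]
    · simp [max_eq_right (sub_nonpos.2 h)]

end

/-- A C*-algebra other than `ℂ` has a representation which does not map every selfadjoint element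
to a scalar. -/
theorem exists_representation.{w} {B : Type w} [CStarAlgebra B] (hB : 1 < Module.rank ℂ B) :
    ∃ (L : Type w) (_ : NormedAddCommGroup L) (_ : InnerProductSpace ℂ L) (_ : CompleteSpace L)
      (ρ : B →⋆ₐ[ℂ] (L →L[ℂ] L)) (b : B), star b = b ∧ ∀ z : ℂ, ρ b ≠ z • 1 := by
  let _ := CStarAlgebra.spectralOrder B
  let _ := CStarAlgebra.spectralOrderedRing B
  obtain ⟨c, d, hc, hd, hc0, hd0, hcd⟩ := exists_orthogonal_nonneg hB
  obtain ⟨φ, hφ⟩ := exists_positiveLinearMap_pos hc hc0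
  obtain ⟨ψ, hψ⟩ := exists_positiveLinearMap_pos hd hd0
  -- One functional that sees both orthogonal elements: if its GNS representation sent `c` and `d`
  -- to scalars `z` and `w`, then `c d = 0` would force `z w = 0`.
  let f : B →ₚ[ℂ] ℂ := PositiveLinearMap.mk₀ ((φ : B →ₗ[ℂ] ℂ) + (ψ : B →ₗ[ℂ] ℂ)) fun x hx =>
    add_nonneg (map_nonneg φ hx) (map_nonneg ψ hx)
  have hf : ∀ x, f x = φ x + ψ x := fun x => rfl
  have hfc : f c ≠ 0 := by
    rw [hf]; exact (add_pos_of_pos_of_nonneg hφ (map_nonneg ψ hc)).ne'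
  have hfd : f d ≠ 0 := by
    rw [hf]; exact (add_pos_of_nonneg_of_pos (map_nonneg φ hd) hψ).ne'
  -- Evaluation at the cyclic vector given by `1`. The functional `f` is not normalised, hence the
  -- factor `f 1`.
  have hscal : ∀ (x : B) (z : ℂ), f.gnsStarAlgHom x = z • 1 → f x = z * f 1 := by
    intro x z h
    have h1 := congrArg (fun T : f.GNS →L[ℂ] f.GNS =>
      (inner ℂ (f.toPreGNS 1 : f.GNS) (T (f.toPreGNS 1 : f.GNS)) : ℂ)) h
    have h2 : f.gnsStarAlgHom x (f.toPreGNS 1 : f.GNS) = (f.toPreGNS (x * 1) : f.GNS) :=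
      f.gnsNonUnitalStarAlgHom_apply_coe
    have h3 : (z • (1 : f.GNS →L[ℂ] f.GNS)) (f.toPreGNS 1 : f.GNS) = z • (f.toPreGNS 1 : f.GNS) :=
      rfl
    rw [h2, h3, inner_smul_right, UniformSpace.Completion.inner_coe,
      UniformSpace.Completion.inner_coe, PositiveLinearMap.preGNS_inner_def,
      PositiveLinearMap.preGNS_inner_def] at h1
    simpa only [PositiveLinearMap.ofPreGNS_toPreGNS, star_one, one_mul, mul_one] using h1
  -- If `c` goes to a scalar, then `d` cannot: `z f(1) = f(c)` and `w f(1) = f(d)` are nonzero,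
  -- whereas `z w f(1) = f(0) = 0`.
  by_cases h : ∃ z : ℂ, f.gnsStarAlgHom c = z • 1
  · refine ⟨f.GNS, inferInstance, inferInstance, inferInstance, f.gnsStarAlgHom, d,
      hd.isSelfAdjoint, fun w hw => ?_⟩
    obtain ⟨z, hz⟩ := h
    have h0 := map_mul f.gnsStarAlgHom c d
    rw [hcd, map_zero, hz, hw, smul_mul_smul_comm, one_mul] at h0
    have h1 := hscal c z hz
    have h2 := hscal d w hw
    have h3 := hscal 0 (z * w) (by rw [map_zero]; exact h0)
    rw [map_zero] at h3
    rw [h1] at hfc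
    rw [h2] at hfd
    exact mul_ne_zero (mul_ne_zero (left_ne_zero_of_mul hfc) (left_ne_zero_of_mul hfd))
      (right_ne_zero_of_mul hfd) h3.symm
  · exact ⟨f.GNS, inferInstance, inferInstance, inferInstance, f.gnsStarAlgHom, c,
      hc.isSelfAdjoint, fun z hz => h ⟨z, hz⟩⟩

end CStarAlgebra

/-! ### Hilbert space tensor products and the two amplifications -/

namespace HilbertTensor

open UniformSpace ContinuousLinearMap

section

variable {E : Type*} [NormedAddCommGroup E] [InnerProductSpace ℂ E]
  {R : Type*} [Ring R] [StarRing R] [Algebra ℂ R]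

/-- A *-representation on an inner product space extends to the completion. -/
def completionHom (π : R →ₐ[ℂ] (E →L[ℂ] E))
    (hπ : ∀ a x y, (inner ℂ (π (star a) x) y : ℂ) = inner ℂ x (π a y)) :
    R →⋆ₐ[ℂ] (Completion E →L[ℂ] Completion E) where
  toFun a := (π a).completion
  map_one' := by
    ext x
    induction x using Completion.induction_on with
    | hp => exact isClosed_eq (by fun_prop) (by fun_prop)
    | ih x => rw [completion_apply_coe, map_one]; rfl
  map_mul' a b := by
    ext x
    induction x using Completion.induction_on with
    | hp => exact isClosed_eq (by fun_prop) (by fun_prop)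
    | ih x =>
      change _ = (π a).completion ((π b).completion x)
      rw [completion_apply_coe, completion_apply_coe, completion_apply_coe, map_mul]; rfl
  map_zero' := by
    ext x
    induction x using Completion.induction_on with
    | hp => exact isClosed_eq (by fun_prop) (by fun_prop)
    | ih x => rw [completion_apply_coe, map_zero]; exact Completion.coe_zero
  map_add' a b := by
    ext x
    induction x using Completion.induction_on with
    | hp => exact isClosed_eq (by fun_prop) (by fun_prop)
    | ih x =>
      change _ = (π a).completion x + (π b).completion x
      rw [completion_apply_coe, completion_apply_coe, completion_apply_coe, map_add]
      exact Completion.coe_add _ _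
  commutes' z := by
    ext x
    induction x using Completion.induction_on with
    | hp => exact isClosed_eq (by fun_prop) (by fun_prop)
    | ih x =>
      rw [completion_apply_coe, AlgHomClass.commutes, Algebra.algebraMap_eq_smul_one,
        Algebra.algebraMap_eq_smul_one]
      exact Completion.coe_smul z x
  map_star' a := by
    refine (eq_adjoint_iff _ _).2 fun x y => ?_
    induction x, y using Completion.induction_on₂ with
    | hp => exact isClosed_eq (by fun_prop) (by fun_prop)
    | ih x y =>
      rw [completion_apply_coe, completion_apply_coe, Completion.inner_coe, Completion.inner_coe,
        hπ]

theorem completionHom_coe (π : R →ₐ[ℂ] (E →L[ℂ] E))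
    (hπ : ∀ a x y, (inner ℂ (π (star a) x) y : ℂ) = inner ℂ x (π a y)) (a : R) (x : E) :
    completionHom π hπ a (x : Completion E) = (π a x : E) :=
  completion_apply_coe _ _

end

variable (H L : Type*) [NormedAddCommGroup H] [InnerProductSpace ℂ H]
  [NormedAddCommGroup L] [InnerProductSpace ℂ L]

/-- The Hilbert space tensor product. -/
abbrev Tensor : Type _ := Completion (H ⊗[ℂ] L)

variable {H L}

/-- An elementary tensor. -/
def tmul (h : H) (l : L) : Tensor H L := ((h ⊗ₜ[ℂ] l : H ⊗[ℂ] L) : Completion (H ⊗[ℂ] L))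

theorem tmul_smul (z : ℂ) (h : H) (l : L) : tmul h (z • l) = z • tmul h l := by
  rw [tmul, TensorProduct.tmul_smul, Completion.coe_smul]; rfl

theorem smul_tmul (z : ℂ) (h : H) (l : L) : tmul (z • h) l = z • tmul h l := by
  rw [tmul, TensorProduct.smul_tmul, TensorProduct.tmul_smul, Completion.coe_smul]; rfl

theorem norm_tmul (h : H) (l : L) : ‖tmul h l‖ = ‖h‖ * ‖l‖ := by
  rw [tmul, Completion.norm_coe, TensorProduct.norm_tmul]

theorem sub_tmul (h h' : H) (l : L) : tmul (h - h') l = tmul h l - tmul h' l := by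
  rw [tmul, TensorProduct.sub_tmul, Completion.coe_sub]; rfl

theorem tmul_sub (h : H) (l l' : L) : tmul h (l - l') = tmul h l - tmul h l' := by
  rw [tmul, TensorProduct.tmul_sub, Completion.coe_sub]; rfl

/-- Elementary tensors span a dense subspace and the form `⟨x, Z y⟩` is continuous and sesquilinear,
so it vanishes identically; then put `x = Z y`. -/
theorem eq_zero_of_inner_tmul {Z : Tensor H L →L[ℂ] Tensor H L}
    (hZ : ∀ (h h' : H) (l l' : L), (inner ℂ (tmul h l) (Z (tmul h' l')) : ℂ) = 0) : Z = 0 := by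
  have key : ∀ x y : H ⊗[ℂ] L, (inner ℂ (x : Tensor H L) (Z (y : Tensor H L)) : ℂ) = 0 := by
    intro x y
    induction x using TensorProduct.induction_on with
    | zero => rw [Completion.coe_zero, inner_zero_left]
    | add x x' hx hx' => rw [Completion.coe_add, inner_add_left, hx, hx', add_zero]
    | tmul h l =>
      induction y using TensorProduct.induction_on with
      | zero => rw [Completion.coe_zero, map_zero, inner_zero_right]
      | add y y' hy hy' => rw [Completion.coe_add, map_add, inner_add_right, hy, hy', add_zero]
      | tmul h' l' => exact hZ h h' l l'
  have key' : ∀ x y : Tensor H L, (inner ℂ x (Z y) : ℂ) = 0 := by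
    intro x y
    induction x, y using Completion.induction_on₂ with
    | hp => exact isClosed_eq (by fun_prop) (by fun_prop)
    | ih x y => exact key x y
  ext y
  exact inner_self_eq_zero.1 (key' _ y)

variable [CompleteSpace H] [CompleteSpace L]

variable (H L) in
/-- The representation `a ↦ a ⊗ 1`. -/
def ampLeft : (H →L[ℂ] H) →⋆ₐ[ℂ] (Tensor H L →L[ℂ] Tensor H L) :=
  completionHom
    (AlgHom.ofLinearMap
      { toFun := fun a : H →L[ℂ] H => a.rTensor L
        map_add' := fun a b => rTensor_add L a b
        map_smul' := fun z a => rTensor_smul L z a } (rTensor_one L) (rTensor_mul L)) (by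
    intro a x y
    change (inner ℂ ((star a).rTensor L x) y : ℂ) = inner ℂ x (a.rTensor L y)
    induction x using TensorProduct.induction_on with
    | zero => rw [map_zero, inner_zero_left, inner_zero_left]
    | add x x' hx hx' => rw [map_add, inner_add_left, inner_add_left, hx, hx']
    | tmul h l =>
      induction y using TensorProduct.induction_on with
      | zero => rw [map_zero, inner_zero_right, inner_zero_right]
      | add y y' hy hy' => rw [map_add, inner_add_right, inner_add_right, hy, hy']
      | tmul h' l' =>
        rw [rTensor_tmul, rTensor_tmul, TensorProduct.inner_tmul, TensorProduct.inner_tmul,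
          star_eq_adjoint, adjoint_inner_left])

variable (H L) in
/-- The representation `b ↦ 1 ⊗ b`. -/
def ampRight : (L →L[ℂ] L) →⋆ₐ[ℂ] (Tensor H L →L[ℂ] Tensor H L) :=
  completionHom
    (AlgHom.ofLinearMap
      { toFun := fun b : L →L[ℂ] L => b.lTensor H
        map_add' := fun a b => lTensor_add H a b
        map_smul' := fun z a => lTensor_smul H z a } (lTensor_one H) (lTensor_mul H)) (by
    intro a x y
    change (inner ℂ ((star a).lTensor H x) y : ℂ) = inner ℂ x (a.lTensor H y)
    induction x using TensorProduct.induction_on with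
    | zero => rw [map_zero, inner_zero_left, inner_zero_left]
    | add x x' hx hx' => rw [map_add, inner_add_left, inner_add_left, hx, hx']
    | tmul h l =>
      induction y using TensorProduct.induction_on with
      | zero => rw [map_zero, inner_zero_right, inner_zero_right]
      | add y y' hy hy' => rw [map_add, inner_add_right, inner_add_right, hy, hy']
      | tmul h' l' =>
        rw [lTensor_tmul, lTensor_tmul, TensorProduct.inner_tmul, TensorProduct.inner_tmul,
          star_eq_adjoint, adjoint_inner_left])

theorem ampLeft_tmul (a : H →L[ℂ] H) (h : H) (l : L) :
    ampLeft H L a (tmul h l) = tmul (a h) l := completionHom_coe _ _ _ _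

theorem ampRight_tmul (b : L →L[ℂ] L) (h : H) (l : L) :
    ampRight H L b (tmul h l) = tmul h (b l) := completionHom_coe _ _ _ _

/-- Test on `x ⊗ l` with a fixed `l ≠ 0`: the norm is multiplicative on elementary tensors, so `(a x
- z x) ⊗ l = 0` forces `a x = z x`. -/
theorem ampLeft_ne_smul_one [Nontrivial L] {a : H →L[ℂ] H} (ha : ∀ z : ℂ, a ≠ z • 1) (z : ℂ) :
    ampLeft H L a ≠ z • 1 := by
  intro h
  obtain ⟨l, hl⟩ := exists_ne (0 : L)
  refine ha z (ContinuousLinearMap.ext fun x => ?_)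
  have h1 : ampLeft H L a (tmul x l) = z • tmul x l := by rw [h]; rfl
  rw [ampLeft_tmul, ← smul_tmul, ← sub_eq_zero, ← sub_tmul, ← norm_eq_zero, norm_tmul,
    mul_eq_zero, norm_eq_zero, norm_eq_zero, sub_eq_zero] at h1
  exact h1.resolve_right hl

theorem ampRight_ne_smul_one [Nontrivial H] {b : L →L[ℂ] L} (hb : ∀ z : ℂ, b ≠ z • 1) (z : ℂ) :
    ampRight H L b ≠ z • 1 := by
  intro h
  obtain ⟨x, hx⟩ := exists_ne (0 : H)
  refine hb z (ContinuousLinearMap.ext fun l => ?_)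
  have h1 : ampRight H L b (tmul x l) = z • tmul x l := by rw [h]; rfl
  rw [ampRight_tmul, ← tmul_smul, ← sub_eq_zero, ← tmul_sub, ← norm_eq_zero, norm_tmul,
    mul_eq_zero, norm_eq_zero, norm_eq_zero, sub_eq_zero] at h1
  exact h1.resolve_left hx

/-- `K(H) ⊗ 1` acts non-degenerately: a nonzero operator on `H ⊗ L` stays nonzero when it is cut
down by suitable rank one operators. -/
theorem exists_rankOne_mul_mul_ne_zero {Z : Tensor H L →L[ℂ] Tensor H L} (hZ : Z ≠ 0) :
    ∃ h h' : H, ampLeft H L (InnerProductSpace.rankOne ℂ h h) * Z *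
      ampLeft H L (InnerProductSpace.rankOne ℂ h' h') ≠ 0 := by
  by_contra! h0
  -- The operator `rankOne h h` is selfadjoint and multiplies `h` by `‖h‖²`. Moving it across the
  -- inner product shows that the cut-down operator has coefficient `‖h‖² ‖h'‖² ⟨h ⊗ l, Z (h' ⊗
  -- l')⟩`, from which the scalars can be cancelled when `h` and `h'` are nonzero.
  have hr : ∀ (h : H) (l : L), ampLeft H L (InnerProductSpace.rankOne ℂ h h) (tmul h l) =
      (inner ℂ h h : ℂ) • tmul h l := fun h l => by
    rw [ampLeft_tmul, InnerProductSpace.rankOne_apply, smul_tmul]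
  have hs : ∀ h : H, star (ampLeft H L (InnerProductSpace.rankOne ℂ h h)) =
      ampLeft H L (InnerProductSpace.rankOne ℂ h h) := fun h => by
    rw [← map_star, star_eq_adjoint, InnerProductSpace.adjoint_rankOne]
  refine hZ (eq_zero_of_inner_tmul fun h h' l l' => ?_)
  by_cases hh : h = 0
  · rw [hh, ← zero_smul ℂ (0 : H), smul_tmul, zero_smul, inner_zero_left]
  by_cases hh' : h' = 0
  · rw [hh', ← zero_smul ℂ (0 : H), smul_tmul, zero_smul, map_zero, inner_zero_right]
  have h1 : (inner ℂ (tmul h l) (ampLeft H L (InnerProductSpace.rankOne ℂ h h)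
      (Z (ampLeft H L (InnerProductSpace.rankOne ℂ h' h') (tmul h' l')))) : ℂ) = 0 := by
    have := congrArg (fun T : Tensor H L →L[ℂ] Tensor H L =>
      (inner ℂ (tmul h l) (T (tmul h' l')) : ℂ)) (h0 h h')
    exact this.trans (inner_zero_right _)
  rw [← adjoint_inner_left, ← star_eq_adjoint, hs, hr, hr, map_smul, inner_smul_left,
    inner_smul_right] at h1
  have e1 : (starRingEnd ℂ) (inner ℂ h h) ≠ 0 := by simpa using hh
  have e2 : (inner ℂ h' h' : ℂ) ≠ 0 := by simpa using hh'
  exact (mul_eq_zero.1 ((mul_eq_zero.1 h1).resolve_left e1)).resolve_left e2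

end HilbertTensor

/-! ### Commutation and detection in amalgamated free products -/

/-- The two factors of a tensor product commute. -/
theorem CStarTensor.inclRight_mul_inclLeft (B E : Type*) [CStarAlgebra B] [CStarAlgebra E] (e : E)
    (b : B) : inclRight B E e * inclLeft B E b = inclLeft B E b * inclRight B E e := by
  refine ((map_mul (ofAlg B E) (algRight B E e) (algLeft B E b)).symm.trans ?_).trans
    (map_mul (ofAlg B E) (algLeft B E b) (algRight B E e))
  congr 1
  change (1 ⊗ₜ[ℂ] e : B ⊗[ℂ] E) * (b ⊗ₜ[ℂ] 1) = (b ⊗ₜ[ℂ] 1) * (1 ⊗ₜ[ℂ] e)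
  rw [Algebra.TensorProduct.tmul_mul_tmul, Algebra.TensorProduct.tmul_mul_tmul, one_mul, one_mul,
    mul_one, mul_one]

/-- `D̃` commutes with `B` in `A *_D̃ (B ⊗ D̃)`. -/
theorem FullAmalgFreeProduct.inl_mul_inr_inclLeft_comm {A B E : Type*} [NonUnitalCStarAlgebra A]
    [CStarAlgebra B] [CStarAlgebra E] (φ : E →⋆ₙₐ[ℂ] A) (e : E) (b : B) :
    inl φ (CStarTensor.inclRight B E) (φ e) *
        inr φ (CStarTensor.inclRight B E) (CStarTensor.inclLeft B E b) =
      inr φ (CStarTensor.inclRight B E) (CStarTensor.inclLeft B E b) *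
        inl φ (CStarTensor.inclRight B E) (φ e) := by
  rw [inl_comp, ← map_mul, ← map_mul, CStarTensor.inclRight_mul_inclLeft]

theorem NonUnitalStarAlgHom.map_mul_mul_sub {P Q : Type*} [NonUnitalCStarAlgebra P]
    [NonUnitalCStarAlgebra Q] (Λ : P →⋆ₙₐ[ℂ] Q) (a b c d e : P) :
    Λ (a * b * c - d * b * e) = Λ a * Λ b * Λ c - Λ d * Λ b * Λ e := by
  rw [map_sub, map_mul, map_mul, map_mul, map_mul]

/-- The element `s` lives in the target and need not come from `P`; it will be the image of `u`,
which factors out of `Λ c` and `Λ d` and passes through `Λ b`. -/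
theorem NonUnitalStarAlgHom.map_mul_mul_sub_eq_zero {P Q : Type*} [NonUnitalCStarAlgebra P]
    [NonUnitalCStarAlgebra Q] (Λ : P →⋆ₙₐ[ℂ] Q) {a b c d e : P} {s : Q} (hc : Λ c = s * Λ e)
    (hd : Λ d = Λ a * s) (hs : s * Λ b = Λ b * s) : Λ (a * b * c - d * b * e) = 0 := by
  rw [map_mul_mul_sub, hc, hd, mul_assoc (Λ a) s, hs, mul_assoc, mul_assoc, mul_assoc, sub_self]

/-- Unital representations of `A` and `B` on the same algebra induce a representation of
`A *_ℂ B`, which detects elements of `A *_ℂ B`. -/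
theorem FullAmalgFreeProduct.mul_mul_sub_ne_zero {A B C : Type*} [CStarAlgebra A]
    [CStarAlgebra B] [CStarAlgebra C] (π : A →⋆ₐ[ℂ] C) (ρ : B →⋆ₐ[ℂ] C) {a c d e : A} {b : B}
    (h : π a * ρ b * π c - π d * ρ b * π e ≠ 0) :
    inl (NonInjective.scalars A) (NonInjective.scalars B) a * inr _ _ b * inl _ _ c -
      inl _ _ d * inr _ _ b * inl _ _ e ≠ 0 := by
  have hD : ∀ z, π.toNonUnitalStarAlgHom (NonInjective.scalars A z) =
      ρ.toNonUnitalStarAlgHom (NonInjective.scalars B z) := fun z =>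
    (AlgHomClass.commutes π z).trans (AlgHomClass.commutes ρ z).symm
  intro h0
  have h1 := congrArg (lift _ _ hD) h0
  rw [NonUnitalStarAlgHom.map_mul_mul_sub, map_zero, lift_inl, lift_inl, lift_inl, lift_inl,
    lift_inr] at h1
  exact h h1

/-! ### A nonzero element of the kernel -/

namespace NonInjective

open CompactPerturbation HilbertTensor

variable {H : Type*} [NormedAddCommGroup H] [InnerProductSpace ℂ H]

/-- Such an operator factors through `ℂ`, where bounded sets are relatively compact. -/
theorem isCompactOperator_rankOne (x y : H) :
    IsCompactOperator (InnerProductSpace.rankOne ℂ x y) := by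
  rw [InnerProductSpace.rankOne_def']
  have h : IsCompactOperator (innerSL ℂ y) :=
    isCompactOperator_of_locallyCompactSpace_dom (innerSL ℂ y)
  exact h.clm_comp (ContinuousLinearMap.toSpanSingleton ℂ x)

variable [CompleteSpace H]

/-- A compact operator as an element of `A = ℂ1 + K(H)`. -/
def compact (k : H →L[ℂ] H) (hk : IsCompactOperator k) : A H :=
  ⟨k, 0, zero_mem _, k, hk, (zero_add k).symm⟩

/-- The element `k b (u k') - (k u) b k'` of `A *_ℂ B`. -/
def commutatorElement (u : H →L[ℂ] H) (B : Type*) [CStarAlgebra B] {k k' : H →L[ℂ] H}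
    (hk : IsCompactOperator k) (hk' : IsCompactOperator k') (b : B) :
    FullAmalgFreeProduct (scalars (A H)) (scalars B) :=
  FullAmalgFreeProduct.inl _ _ (compact k hk) * FullAmalgFreeProduct.inr _ _ b *
      FullAmalgFreeProduct.inl _ _ (compact (u * k') (hk'.clm_comp u)) -
    FullAmalgFreeProduct.inl _ _ (compact (k * u) (hk.comp_clm u)) *
      FullAmalgFreeProduct.inr _ _ b * FullAmalgFreeProduct.inl _ _ (compact k' hk')

/-- Inside `Ã` the compacts `u k'` and `k u` split off the factor `u ∈ D̃`. The amalgamation over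
`D̃` lets this factor move past `b ⊗ 1`, after which the two terms coincide. -/
theorem lam_commutatorElement (u : H →L[ℂ] H) (B : Type*) [CStarAlgebra B] {k k' : H →L[ℂ] H}
    (hk : IsCompactOperator k) (hk' : IsCompactOperator k') (b : B) :
    lam u B (commutatorElement u B hk hk' b) = 0 := by
  let v : Dt u := ⟨u, StarAlgebra.elemental.self_mem ℂ u⟩
  have h1 : inclA u (compact (u * k') (hk'.clm_comp u)) =
      inclDt u v * inclA u (compact k' hk') := Subtype.ext rfl
  have h2 : inclA u (compact (k * u) (hk.comp_clm u)) =
      inclA u (compact k hk) * inclDt u v := Subtype.ext rfl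
  let σ := FullAmalgFreeProduct.inl (inclDt u) (CStarTensor.inclRight B (Dt u))
  have hl : ∀ a, lam u B (FullAmalgFreeProduct.inl _ _ a) = σ (inclA u a) :=
    FullAmalgFreeProduct.map_inl _ _ _ _ _
  refine NonUnitalStarAlgHom.map_mul_mul_sub_eq_zero (lam u B) (s := σ (inclDt u v)) ?_ ?_ ?_
  · exact (hl _).trans ((congrArg σ h1).trans ((map_mul σ _ _).trans
      (congrArg (fun t => σ (inclDt u v) * t) (hl _).symm)))
  · exact (hl _).trans ((congrArg σ h2).trans ((map_mul σ _ _).trans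
      (congrArg (fun t => t * σ (inclDt u v)) (hl _).symm)))
  · have hr : lam u B (FullAmalgFreeProduct.inr _ _ b) = FullAmalgFreeProduct.inr (inclDt u)
        (CStarTensor.inclRight B (Dt u)) (CStarTensor.inclLeft B (Dt u) b) :=
      FullAmalgFreeProduct.map_inr _ _ _ _ _ b
    rw [hr]
    exact FullAmalgFreeProduct.inl_mul_inr_inclLeft_comm (inclDt u) v b

/-- Nonvanishing is seen in one representation on `H ⊗ L`, in which `A` and `B` are placed in a
position where `b` does not commute with `u`. -/
theorem exists_commutatorElement_ne_zero [Nontrivial H] {u : H →L[ℂ] H}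
    (hu : ∀ z : ℂ, u ≠ z • 1) {B : Type*} [CStarAlgebra B] (hB : 1 < Module.rank ℂ B) :
    ∃ (k k' : H →L[ℂ] H) (hk : IsCompactOperator k) (hk' : IsCompactOperator k') (b : B),
      commutatorElement u B hk hk' b ≠ 0 := by
  obtain ⟨L, _, _, _, ρ, b, hb, hρ⟩ := CStarAlgebra.exists_representation hB
  have : Nontrivial L := by
    by_contra h
    have := not_nontrivial_iff_subsingleton.1 h
    exact hρ 0 (ContinuousLinearMap.ext fun x => Subsingleton.elim _ _)
  -- The amplifications `1 ⊗ ρ b` and `u ⊗ 1` commute, so one of them has to be twisted by `W`.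
  -- Conjugation keeps the representation of `B` unital, and unitality is all that compatibility
  -- over `ℂ` requires.
  obtain ⟨W, hW, hWc⟩ := ContinuousLinearMap.exists_unitary_conj_not_commute
    (T := ampRight H L (ρ b)) (by rw [← map_star, ← map_star, hb])
    (ampRight_ne_smul_one hρ) (ampLeft_ne_smul_one (L := L) hu)
  let S : B →⋆ₐ[ℂ] (Tensor H L →L[ℂ] Tensor H L) :=
    ((Unitary.conjStarAlgAut ℂ (Tensor H L →L[ℂ] Tensor H L) ⟨W, hW⟩ :
      (Tensor H L →L[ℂ] Tensor H L) ≃⋆ₐ[ℂ] (Tensor H L →L[ℂ] Tensor H L)) :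
        (Tensor H L →L[ℂ] Tensor H L) →⋆ₐ[ℂ] (Tensor H L →L[ℂ] Tensor H L)).comp
      ((ampRight H L).comp ρ)
  have hS : S b = W * ampRight H L (ρ b) * star W := rfl
  let π : A H →⋆ₐ[ℂ] (Tensor H L →L[ℂ] Tensor H L) := (ampLeft H L).comp (A H).subtype
  -- The commutator itself involves `u`, which may lie outside `A`; between two compact factors it
  -- becomes the image of an element of `A *_ℂ B`.
  obtain ⟨h, h', hne⟩ := exists_rankOne_mul_mul_ne_zero (Z := S b * ampLeft H L u -
    ampLeft H L u * S b) fun h0 => hWc (sub_eq_zero.1 h0)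
  refine ⟨_, _, isCompactOperator_rankOne h h, isCompactOperator_rankOne h' h', b,
    FullAmalgFreeProduct.mul_mul_sub_ne_zero (C := Tensor H L →L[ℂ] Tensor H L) π S ?_⟩
  change ampLeft H L (InnerProductSpace.rankOne ℂ h h) * S b *
    ampLeft H L (u * InnerProductSpace.rankOne ℂ h' h') -
    ampLeft H L (InnerProductSpace.rankOne ℂ h h * u) * S b *
    ampLeft H L (InnerProductSpace.rankOne ℂ h' h') ≠ 0
  rw [map_mul, map_mul]
  refine fun h0 => hne (Eq.trans ?_ h0)
  noncomm_ring

end NonInjective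

end

theorem mainTheorem8 {H : Type*} [NormedAddCommGroup H] [InnerProductSpace ℂ H]
    [CompleteSpace H] [TopologicalSpace.SeparableSpace H] (hH : ¬ FiniteDimensional ℂ H)
    (u : H →L[ℂ] H) (hu : u ∈ unitary (H →L[ℂ] H))
    (hu1 : u ∉ (⊥ : StarSubalgebra ℂ (H →L[ℂ] H)))
    {B : Type*} [CStarAlgebra B] (hB : 1 < Module.rank ℂ B) :
    ¬ Function.Injective (NonInjective.lam u B) := by
  have : Nontrivial H := by
    by_contra h
    have := not_nontrivial_iff_subsingleton.1 h
    exact hH inferInstance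
  have hu' : ∀ z : ℂ, u ≠ z • 1 := fun z hz =>
    hu1 (StarSubalgebra.mem_bot.2 ⟨z, by rw [hz, Algebra.algebraMap_eq_smul_one]⟩)
  obtain ⟨k, k', hk, hk', b, hne⟩ := NonInjective.exists_commutatorElement_ne_zero hu' hB
  exact fun hinj => hne (hinj ((NonInjective.lam_commutatorElement u B hk hk' b).trans
    (map_zero _).symm))
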